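/- Let $0<\alpha\le 2$, let $p\neq q$ be integers, and for $n=\lceil\beta\rceil$, $\beta>0$, let the left and right Riemann–Liouville derivatives on $\mathbb R$ be $${}_{-\infty}D_x^{\beta}u(x)=\frac{1}{\Gamma(n-\beta)}\frac{d^n}{dx^n}\int_{-\infty}^x\frac{u(\xi)}{(x-\xi)^{\beta-n+1}}\,d\xi,\qquad {}_{x}D_\infty^{\beta}u(x)=\frac{(-1)^n}{\Gamma(n-\beta)}\frac{d^n}{dx^n}\int_x^{\infty}\frac{u(\xi)}{(\xi-x)^{\beta-n+1}}\,d\xi$$ if $n-1<\beta<n$, and $u^{(n)}(x)$, $(-1)^nu^{(n)}(x)$ respectively if $\beta=n$. Let $g_k^{(\alpha)}=(-1)^k\binom{\alpha}{k}$, $\mu_1=\frac{\alpha-2q}{2(p-q)}$, $\mu_2=\frac{2p-\alpha}{2(p-q)}$, and for $h>0$ let the weighted and shifted Grünwald difference (WSGD) operators be $${}_L\mathcal D^\alpha_{h,p,q}u(x)=\frac1{h^\alpha}\sum_{k=0}^\infty g_k^{(\alpha)}\bigl(\mu_1u(x-(k-p)h)+\mu_2u(x-(k-q)h)\bigr),$$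 $${}_R\mathcal D^\alpha_{h,p,q}u(x)=\frac1{h^\alpha}\sum_{k=0}^\infty g_k^{(\alpha)}\bigl(\mu_1u(x+(k-p)h)+\mu_2u(x+(k-q)h)\bigr).$$ For an integer $r$ let $a^\alpha_{r,l}$ be the coefficients of the power series $\left(\frac{1-e^{-z}}{z}\right)^\alpha e^{rz}=\sum_{l\ge0}a^\alpha_{r,l}z^l$ at $0$, put $c^\alpha_{p,q,l}=\mu_1a^\alpha_{p,l}+\mu_2a^\alpha_{q,l}$, and let $\mathcal C_x=1+c^\alpha_{p,q,2}h^2\delta_x^2$, where $\delta_x^2f(x)=(f(x-h)-2f(x)+f(x+h))/h^2$. Let $u\in C^7(\mathbb R)$ be real-valued with $u^{(k)}\in L^1(\mathbb R)$ for $0\le k\le 7$, and suppose that ${}_{-\infty}D_x^{\alpha+2}u$, ${}_xD_\infty^{\alpha+2}u$ and their Fourier transforms belong to $L^1(\mathbb R)$. Then the Riemann–Liouville derivatives of $u$ of orders $\alpha$ and $\alpha+3$ exist everywhere and are continuous, the series above converge absolutely, and, as $h\to0^+$, $${}_L\mathcal D^\alpha_{h,p,q}u(x)=\mathcal C_x\bigl({}_{-\infty}D_x^\alpha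 u\bigr)(x)+c^\alpha_{p,q,3}\,{}_{-\infty}D_x^{\alpha+3}u(x)\,h^3+O(h^4),$$ $${}_R\mathcal D^\alpha_{h,p,q}u(x)=\mathcal C_x\bigl({}_xD_\infty^\alpha u\bigr)(x)+c^\alpha_{p,q,3}\,{}_xD_\infty^{\alpha+3}u(x)\,h^3+O(h^4),$$ uniformly for $x\in\mathbb R$. In particular ${}_L\mathcal D^\alpha_{h,p,q}u=\mathcal C_x({}_{-\infty}D_x^\alpha u)+O(h^3)$ and ${}_R\mathcal D^\alpha_{h,p,q}u=\mathcal C_x({}_xD_\infty^\alpha u)+O(h^3)$ uniformly on $\mathbb R$. -/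

import Mathlib

open scoped FourierTransform

noncomputable section

namespace CWSGD

/-- `∫_{-∞}^x u(ξ) / (x - ξ)^s dξ`. -/
def leftKernelIntegral (s : ℝ) (u : ℝ → ℝ) (x : ℝ) : ℝ :=
  ∫ ξ in Set.Iio x, u ξ / (x - ξ) ^ s

/-- `∫_x^∞ u(ξ) / (ξ - x)^s dξ`. -/
def rightKernelIntegral (s : ℝ) (u : ℝ → ℝ) (x : ℝ) : ℝ :=
  ∫ ξ in Set.Ioi x, u ξ / (ξ - x) ^ s

open Classical in
/-- The left Riemann–Liouville derivative of order `α` on `ℝ`, with `n = ⌈α⌉`: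
the ordinary `n`-th derivative if `α = n`, and
`1 / Γ(n - α) * (d/dx)^n ∫_{-∞}^x u(ξ) / (x - ξ)^(α - n + 1) dξ` if `n - 1 < α < n`. -/
def leftRL (α : ℝ) (u : ℝ → ℝ) : ℝ → ℝ := fun x =>
  if α = (⌈α⌉₊ : ℝ) then iteratedDeriv ⌈α⌉₊ u x
  else 1 / Real.Gamma ((⌈α⌉₊ : ℝ) - α) *
    iteratedDeriv ⌈α⌉₊ (leftKernelIntegral (α - (⌈α⌉₊ : ℝ) + 1) u) x

open Classical in
/-- The right Riemann–Liouville derivative of order `α` on `ℝ`, with `n = ⌈α⌉`: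
`(-1)^n` times the ordinary `n`-th derivative if `α = n`, and
`(-1)^n / Γ(n - α) * (d/dx)^n ∫_x^∞ u(ξ) / (ξ - x)^(α - n + 1) dξ` if `n - 1 < α < n`. -/
def rightRL (α : ℝ) (u : ℝ → ℝ) : ℝ → ℝ := fun x =>
  if α = (⌈α⌉₊ : ℝ) then (-1) ^ ⌈α⌉₊ * iteratedDeriv ⌈α⌉₊ u x
  else (-1) ^ ⌈α⌉₊ / Real.Gamma ((⌈α⌉₊ : ℝ) - α) *
    iteratedDeriv ⌈α⌉₊ (rightKernelIntegral (α - (⌈α⌉₊ : ℝ) + 1) u) x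

/-- The left Riemann–Liouville derivative of order `α` of `u` exists at every point and is
continuous: the integral in its definition converges absolutely, and the derivative in its
definition is a genuine one. -/
def LeftRLExists (α : ℝ) (u : ℝ → ℝ) : Prop :=
  (α = (⌈α⌉₊ : ℝ) → ContDiff ℝ ⌈α⌉₊ u) ∧
  (α ≠ (⌈α⌉₊ : ℝ) →
    (∀ x : ℝ, MeasureTheory.IntegrableOn
      (fun ξ => u ξ / (x - ξ) ^ (α - (⌈α⌉₊ : ℝ) + 1)) (Set.Iio x)) ∧
    ContDiff ℝ ⌈α⌉₊ (leftKernelIntegral (α - (⌈α⌉₊ : ℝ) + 1) u))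

/-- The right Riemann–Liouville derivative of order `α` of `u` exists at every point and is
continuous. -/
def RightRLExists (α : ℝ) (u : ℝ → ℝ) : Prop :=
  (α = (⌈α⌉₊ : ℝ) → ContDiff ℝ ⌈α⌉₊ u) ∧
  (α ≠ (⌈α⌉₊ : ℝ) →
    (∀ x : ℝ, MeasureTheory.IntegrableOn
      (fun ξ => u ξ / (ξ - x) ^ (α - (⌈α⌉₊ : ℝ) + 1)) (Set.Ioi x)) ∧
    ContDiff ℝ ⌈α⌉₊ (rightKernelIntegral (α - (⌈α⌉₊ : ℝ) + 1) u))

/-- The Grünwald coefficients `g_k = (-1)^k * binom(α, k)`. -/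
def g (α : ℝ) (k : ℕ) : ℝ := (-1) ^ k * Ring.choose α k

/-- The weight `(α - 2 q) / (2 (p - q))`. -/
def mu1 (α : ℝ) (p q : ℤ) : ℝ := (α - 2 * q) / (2 * (p - q))

/-- The weight `(2 p - α) / (2 (p - q))`. -/
def mu2 (α : ℝ) (p q : ℤ) : ℝ := (2 * p - α) / (2 * (p - q))

/-- The `k`-th term of the series in the left WSGD operator. -/
def leftTerm (α : ℝ) (p q : ℤ) (u : ℝ → ℝ) (h x : ℝ) (k : ℕ) : ℝ :=
  g α k * (mu1 α p q * u (x - ((k : ℝ) - p) * h) + mu2 α p q * u (x - ((k : ℝ) - q) * h))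

/-- The `k`-th term of the series in the right WSGD operator. -/
def rightTerm (α : ℝ) (p q : ℤ) (u : ℝ → ℝ) (h x : ℝ) (k : ℕ) : ℝ :=
  g α k * (mu1 α p q * u (x + ((k : ℝ) - p) * h) + mu2 α p q * u (x + ((k : ℝ) - q) * h))

/-- The left weighted and shifted Grünwald difference operator. -/
def leftWSGD (α : ℝ) (p q : ℤ) (u : ℝ → ℝ) (h x : ℝ) : ℝ :=
  1 / h ^ α * ∑' k : ℕ, leftTerm α p q u h x k

/-- The right weighted and shifted Grünwald difference operator. -/
def rightWSGD (α : ℝ) (p q : ℤ) (u : ℝ → ℝ) (h x : ℝ) : ℝ :=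
  1 / h ^ α * ∑' k : ℕ, rightTerm α p q u h x k

open Classical in
/-- `w(z) = ((1 - e^{-z}) / z)^α * e^{p z}`, with the removable singularity at `0` filled in.
The base of the power is positive for every real `z ≠ 0`. -/
def w (α : ℝ) (p : ℤ) (z : ℝ) : ℝ :=
  if z = 0 then 1 else ((1 - Real.exp (-z)) / z) ^ α * Real.exp (p * z)

/-- The coefficient of `z^l` in the power series expansion of `w` at `0`. -/
def a (α : ℝ) (p : ℤ) (l : ℕ) : ℝ := iteratedDeriv l (w α p) 0 / (l.factorial : ℝ)

/-- `c_{p,q,l} = mu1 * a_{p,l} + mu2 * a_{q,l}`. -/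
def c (α : ℝ) (p q : ℤ) (l : ℕ) : ℝ := mu1 α p q * a α p l + mu2 α p q * a α q l

/-- The second order central difference operator `δ_x^2` with step `h`. -/
def centralDiff (h : ℝ) (f : ℝ → ℝ) (x : ℝ) : ℝ :=
  (f (x - h) - 2 * f x + f (x + h)) / h ^ 2

/-- The compact operator `C_x = 1 + c_{p,q,2} h^2 δ_x^2`. -/
def compactOp (α : ℝ) (p q : ℤ) (h : ℝ) (f : ℝ → ℝ) (x : ℝ) : ℝ :=
  f x + c α p q 2 * h ^ 2 * centralDiff h f x

/-- `E(h, x) = O(h^m)` as `h → 0+`, uniformly for `x ∈ ℝ`. -/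
def UniformBigO (E : ℝ → ℝ → ℝ) (m : ℕ) : Prop :=
  ∃ C h₀ : ℝ, 0 < h₀ ∧ ∀ h : ℝ, 0 < h → h < h₀ → ∀ x : ℝ, |E h x| ≤ C * h ^ m

end CWSGD

end

/-!
Write `û` for the Fourier transform of `u` and `z = 2πik`. The hypotheses on `u` give
`û(k) = O((1 + |k|)^{-7})`, so that `|k|^γ û` is integrable
for `-1 < γ < 6`, and Fourier inversion applies.

* The Riemann–Liouville derivative of order `0 < β ≤ 5` is the Fourier multiplier `z^β` with the
  principal branch (`leftRLExists_and_eq_fourierInv`). For fractional `β` the kernel integral is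
  evaluated with a convergence factor `e^{-εt}` by Fubini's theorem and Euler's integral
  `∫₀^∞ t^{a-1} e^{-rt} dt = Γ(a) r^{-a}`, `Re r > 0`, and then `ε → 0`; the remaining integer
  derivatives are taken under the inverse Fourier transform.
* The Grünwald coefficients are absolutely summable and their generating function is `(1 - ζ)^α`
  on the closed unit disc. Hence the WSGD operator is the multiplier
  `h^{-α} (μ₁ e^{pzh} + μ₂ e^{qzh}) (1 - e^{-zh})^α` (`ofReal_tsum_leftTerm`).
* By definition of the coefficients `c_l`, and because `c_0 = 1` and `c_1 = 0`, the symbols of the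
  two sides of the expansion differ by `h^{-α} O(|zh|^{α+4})` on the whole imaginary axis
  (`norm_symbol_sub_le`). If `α < 2`, then `|k|^{α+4} û` is integrable and the uniform bound
  `O(h⁴)` follows.
* If `α = 2`, then `|k|⁶ û` may fail to be integrable. In this case the Grünwald sum is finite and
  everything is a finite difference; Taylor's formula with `u⁽⁶⁾` bounded gives the remainder, and
  the same comparison of symbols at `z = 0` identifies the Taylor coefficients (`moment_eq`).

The right-sided statements are the left-sided ones for the reflected function `x ↦ u (-x)`.
-/

namespace CWSGD

open MeasureTheory Filter Topology Set

/-! ### Euler's integral in the right half-plane -/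

lemma integrableOn_rpow_mul_exp {b r : ℝ} (hb : -1 < b) (hr : 0 < r) :
    IntegrableOn (fun t : ℝ => t ^ b * Real.exp (-(r * t))) (Ioi 0) := by
  simpa [Real.rpow_one] using integrableOn_rpow_mul_exp_neg_mul_rpow hb one_pos hr

lemma norm_rpow_mul_cexp {b t : ℝ} (ht : 0 < t) (r : ℂ) :
    ‖((t ^ b : ℝ) : ℂ) * Complex.exp (-(r * t))‖ = t ^ b * Real.exp (-(r.re * t)) := by
  rw [norm_mul, Complex.norm_real, Complex.norm_exp, Real.norm_of_nonneg (by positivity)]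
  simp

lemma aestronglyMeasurable_rpow_mul_cexp (b : ℝ) (r : ℂ) (μ : Measure ℝ) :
    AEStronglyMeasurable (fun t : ℝ => ((t ^ b : ℝ) : ℂ) * Complex.exp (-(r * t))) μ := by
  have : Measurable (fun t : ℝ => ((t ^ b : ℝ) : ℂ) * Complex.exp (-(r * t))) := by fun_prop
  exact this.aestronglyMeasurable

lemma integrableOn_rpow_mul_cexp {b : ℝ} {r : ℂ} (hb : -1 < b) (hr : 0 < r.re) :
    IntegrableOn (fun t : ℝ => ((t ^ b : ℝ) : ℂ) * Complex.exp (-(r * t))) (Ioi 0) := by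
  refine (integrableOn_rpow_mul_exp hb hr).mono' (aestronglyMeasurable_rpow_mul_cexp _ _ _) ?_
  filter_upwards [ae_restrict_mem measurableSet_Ioi] with t ht
  exact (norm_rpow_mul_cexp ht r).le

lemma differentiableAt_integral_rpow_mul_cexp {b : ℝ} {r : ℂ} (hb : -1 < b) (hr : 0 < r.re) :
    DifferentiableAt ℂ
      (fun r : ℂ => ∫ t in Ioi (0 : ℝ), ((t ^ b : ℝ) : ℂ) * Complex.exp (-(r * t))) r := by
  have hU : {w : ℂ | r.re / 2 < w.re} ∈ 𝓝 r :=
    (isOpen_lt continuous_const Complex.continuous_re).mem_nhds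
      (show r.re / 2 < r.re by linarith)
  refine (hasDerivAt_integral_of_dominated_loc_of_deriv_le (μ := volume.restrict (Ioi 0))
    (F := fun (r : ℂ) (t : ℝ) => ((t ^ b : ℝ) : ℂ) * Complex.exp (-(r * t)))
    (F' := fun (r : ℂ) (t : ℝ) => -(((t ^ (b + 1) : ℝ) : ℂ) * Complex.exp (-(r * t))))
    (bound := fun t => t ^ (b + 1) * Real.exp (-(r.re / 2 * t))) hU
    (Eventually.of_forall fun w => aestronglyMeasurable_rpow_mul_cexp _ _ _)
    (integrableOn_rpow_mul_cexp hb hr) (aestronglyMeasurable_rpow_mul_cexp _ _ _).neg ?_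
    (integrableOn_rpow_mul_exp (by linarith) (by linarith)) ?_).2.differentiableAt
  · filter_upwards [ae_restrict_mem measurableSet_Ioi] with t ht w hw
    have ht' : (0 : ℝ) < t := ht
    rw [norm_neg, norm_rpow_mul_cexp ht]
    have : r.re / 2 * t ≤ w.re * t := mul_le_mul_of_nonneg_right (le_of_lt hw) ht'.le
    gcongr
  · filter_upwards [ae_restrict_mem measurableSet_Ioi] with t ht w _
    have ht' : (0 : ℝ) < t := ht
    have h1 : HasDerivAt (fun w : ℂ => Complex.exp (-(w * t)))
        (Complex.exp (-(w * t)) * (-(1 * t))) w :=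
      (((hasDerivAt_id w).mul_const (t : ℂ)).neg).cexp
    convert! h1.const_mul ((t ^ b : ℝ) : ℂ) using 1
    rw [Real.rpow_add_one ht'.ne']
    push_cast
    ring

/-- Euler's integral `∫₀^∞ t^{a-1} e^{-rt} dt = Γ(a) r^{-a}` for complex `r` in the right
half-plane: both sides are analytic in `r` and agree on the positive half-axis. -/
lemma integral_rpow_mul_cexp {a : ℝ} {r : ℂ} (ha : 0 < a) (hr : 0 < r.re) :
    ∫ t in Ioi (0 : ℝ), ((t ^ (a - 1) : ℝ) : ℂ) * Complex.exp (-(r * t)) =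
      (Real.Gamma a : ℂ) * r ^ (-(a : ℂ)) := by
  set U : Set ℂ := {w : ℂ | 0 < w.re} with hUdef
  have hUo : IsOpen U := isOpen_lt continuous_const Complex.continuous_re
  have hUc : IsPreconnected U := (convex_halfSpace_re_gt 0).isPreconnected
  set F : ℂ → ℂ := fun r => ∫ t in Ioi (0 : ℝ), ((t ^ (a - 1) : ℝ) : ℂ) * Complex.exp (-(r * t))
  set G : ℂ → ℂ := fun r => (Real.Gamma a : ℂ) * r ^ (-(a : ℂ))
  have hF : AnalyticOnNhd ℂ F U := DifferentiableOn.analyticOnNhd (fun w hw =>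
    (differentiableAt_integral_rpow_mul_cexp (by linarith) hw).differentiableWithinAt) hUo
  have hG : AnalyticOnNhd ℂ G U := DifferentiableOn.analyticOnNhd (fun w hw =>
    ((differentiableAt_id.cpow_const (Or.inl hw)).const_mul _).differentiableWithinAt) hUo
  have hreal : ∀ x : ℝ, 0 < x → F x = G x := by
    intro x hx
    have h := Real.integral_rpow_mul_exp_neg_mul_Ioi ha hx
    simp only [F, G]
    rw [← Complex.ofReal_neg, ← Complex.ofReal_cpow hx.le, Real.rpow_neg hx.le,
      ← Real.inv_rpow hx.le, ← Complex.ofReal_mul, mul_comm, ← one_div, ← h, ← integral_complex_ofReal]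
    push_cast
    rfl
  have hfreq : ∃ᶠ w in 𝓝[≠] (1 : ℂ), F w = G w := by
    have ht : Tendsto (fun n : ℕ => ((1 + 1 / ((n : ℝ) + 1) : ℝ) : ℂ)) atTop (𝓝[≠] (1 : ℂ)) := by
      refine tendsto_nhdsWithin_iff.2 ⟨?_, Eventually.of_forall fun n => ?_⟩
      · have : Tendsto (fun n : ℕ => 1 + 1 / ((n : ℝ) + 1)) atTop (𝓝 (1 + 0)) :=
          tendsto_const_nhds.add tendsto_one_div_add_atTop_nhds_zero_nat
        simpa [Function.comp_def] using (Complex.continuous_ofReal.tendsto _).comp this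
      · have : (0 : ℝ) < 1 / ((n : ℝ) + 1) := by positivity
        simp only [mem_compl_iff, mem_singleton_iff]
        intro h
        have h2 : (1 + 1 / ((n : ℝ) + 1) : ℝ) = 1 := by exact_mod_cast h
        linarith
    refine ht.frequently (Frequently.of_forall fun n => hreal _ (by positivity))
  exact hF.eqOn_of_preconnected_of_frequently_eq hG hUc (by simp [U]) hfreq hr

/-! ### Iterated derivatives of real functions viewed as complex ones -/

lemma deriv_ofReal_comp {f : ℝ → ℝ} (hf : Differentiable ℝ f) :
    deriv (fun x => (f x : ℂ)) = fun x => ((deriv f x : ℝ) : ℂ) :=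
  funext fun x => (hf x).hasDerivAt.ofReal_comp.deriv

lemma iteratedDeriv_ofReal_comp {f : ℝ → ℝ} {n : ℕ} (hf : ContDiff ℝ n f) (x : ℝ) :
    iteratedDeriv n (fun x => (f x : ℂ)) x = ((iteratedDeriv n f x : ℝ) : ℂ) := by
  induction n generalizing f with
  | zero => simp
  | succ n ih =>
    have h := (contDiff_succ_iff_deriv (n := n)).1 (by exact_mod_cast hf)
    rw [iteratedDeriv_succ', iteratedDeriv_succ', deriv_ofReal_comp h.1, ih h.2.2]

/-! ### Grünwald coefficients -/

lemma choose_succ_mul (α : ℝ) (k : ℕ) :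
    ((k : ℝ) + 1) * Ring.choose α (k + 1) = (α - k) * Ring.choose α k := by
  have h1 := Ring.descPochhammer_eq_factorial_smul_choose α (k + 1)
  have h2 := Ring.descPochhammer_eq_factorial_smul_choose α k
  rw [descPochhammer_succ_right, Polynomial.smeval_mul, h2] at h1
  simp [Polynomial.smeval_sub, Polynomial.smeval_natCast, Nat.factorial_succ] at h1
  have h3 : ((k.factorial : ℕ) : ℝ) ≠ 0 := by positivity
  apply mul_left_cancel₀ h3
  linarith

lemma g_succ_mul (α : ℝ) (k : ℕ) : ((k : ℝ) + 1) * g α (k + 1) = (k - α) * g α k := by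
  have := choose_succ_mul α k
  simp only [g, pow_succ]
  linear_combination (-(-1) ^ k) * this

/-- `∑ |g_k|` converges: from the index `2` on, `α |g_k| = k |g_k| - (k + 1) |g_{k+1}|`
telescopes. -/
lemma summable_abs_g {α : ℝ} (hα₀ : 0 < α) (hα₂ : α ≤ 2) : Summable fun k => |g α k| := by
  rw [← summable_nat_add_iff 2]
  have key : ∀ N : ℕ, α * ∑ k ∈ Finset.range N, |g α (k + 2)| =
      2 * |g α 2| - (N + 2) * |g α (N + 2)| := by
    intro N
    induction N with
    | zero => simp
    | succ N ih =>
      have h := congrArg abs (g_succ_mul α (N + 2))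
      push_cast at h
      rw [abs_mul, abs_mul, abs_of_pos (by positivity : (0 : ℝ) < (N : ℝ) + 2 + 1),
        abs_of_nonneg (by have := N.cast_nonneg (α := ℝ); linarith : (0 : ℝ) ≤ (N : ℝ) + 2 - α)] at h
      rw [Finset.sum_range_succ, mul_add, ih, show N + 1 + 2 = N + 2 + 1 by ring]
      push_cast
      linear_combination h
  refine summable_of_sum_range_le (c := 2 * |g α 2| / α) (fun _ => abs_nonneg _) fun N => ?_
  rw [le_div_iff₀ hα₀, mul_comm, key]
  have : (0 : ℝ) ≤ (N + 2) * |g α (N + 2)| := by positivity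
  linarith

/-- The generating function `∑ g_k ζ^k = (1 - ζ)^α` of the Grünwald coefficients on the closed
unit disc. -/
lemma tsum_g_mul_pow {α : ℝ} (hα₀ : 0 < α) (hα₂ : α ≤ 2) {ζ : ℂ} (hζ : ‖ζ‖ ≤ 1) :
    ∑' k : ℕ, (g α k : ℂ) * ζ ^ k = (1 - ζ) ^ (α : ℂ) := by
  have hopen : ∀ w : ℂ, ‖w‖ < 1 → ∑' k : ℕ, (g α k : ℂ) * w ^ k = (1 - w) ^ (α : ℂ) := by
    intro w hw
    have h := (Complex.one_add_cpow_hasFPowerSeriesOnBall_zero (a := (α : ℂ))).hasSum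
      (y := -w) (by rw [← ENNReal.ofReal_one, Metric.eball_ofReal]; simpa using hw)
    simp only [zero_add, binomialSeries_apply, List.ofFn_const, List.prod_replicate,
      smul_eq_mul] at h
    rw [sub_eq_add_neg, ← h.tsum_eq]
    refine tsum_congr fun k => ?_
    simp only [g]
    push_cast
    rw [neg_pow w k]
    ring
  -- Radial limit `t → 1⁻` of the identity at `tζ`; the parameter is clamped to `[-1, 1]` so that the
  -- series converges uniformly on all of `ℝ`.
  have hcont1 : Continuous fun t : ℝ =>
      ∑' k : ℕ, (g α k : ℂ) * ((max (-1) (min t 1) : ℝ) * ζ) ^ k := by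
    refine continuous_tsum (u := fun k => |g α k|) (fun k => by fun_prop)
      (summable_abs_g hα₀ hα₂) fun k t => ?_
    rw [norm_mul, Complex.norm_real, Real.norm_eq_abs, norm_pow]
    refine mul_le_of_le_one_right (abs_nonneg _) (pow_le_one₀ (norm_nonneg _) ?_)
    rw [norm_mul, Complex.norm_real, Real.norm_eq_abs]
    exact mul_le_one₀ (abs_le.2 ⟨le_max_left _ _, max_le (by norm_num) (min_le_right _ _)⟩)
      (norm_nonneg _) hζ
  have hmem : ∀ t : ℝ, t ∈ Ioo (0 : ℝ) 1 →  max (-1) (min t 1) = t := by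
    rintro t ⟨h0, h1⟩
    rw [min_eq_left h1.le, max_eq_right (by linarith)]
  have hlim1 : Tendsto (fun t : ℝ => ∑' k : ℕ, (g α k : ℂ) * ((max (-1) (min t 1) : ℝ) * ζ) ^ k)
      (𝓝[<] 1) (𝓝 (∑' k : ℕ, (g α k : ℂ) * ζ ^ k)) := by
    have := (hcont1.tendsto 1).mono_left (nhdsWithin_le_nhds (s := Iio 1))
    simpa using this
  have hlim2 : Tendsto (fun t : ℝ => (1 - (t : ℂ) * ζ) ^ (α : ℂ))
      (𝓝[<] 1) (𝓝 ((1 - ζ) ^ (α : ℂ))) := by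
    have hc : ContinuousAt (fun w : ℂ => w ^ (α : ℂ)) (1 - ζ) := by
      by_cases h : ζ = 1
      · subst h
        rw [sub_self]
        exact Complex.continuousAt_cpow_const_of_re_pos (by simp) (by simpa using hα₀)
      · refine continuousAt_cpow_const (Or.inl ?_)
        have h1 : ζ.re ≤ 1 := (Complex.re_le_norm ζ).trans hζ
        have h2 : ζ.re ≠ 1 := by
          intro h2
          apply h
          have h3 := Complex.sq_norm_sub_sq_re ζ
          have h4 : ‖ζ‖ ^ 2 ≤ 1 := pow_le_one₀ (norm_nonneg _) hζ
          have h5 : ζ.im ^ 2 ≤ 0 := by rw [← h3, h2]; linarith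
          exact Complex.ext h2 (by simpa using pow_eq_zero_iff (two_ne_zero) |>.1 (le_antisymm h5 (sq_nonneg _)))
        have := lt_of_le_of_ne h1 h2
        simpa using this
    have h2 : Tendsto (fun t : ℝ => 1 - (t : ℂ) * ζ) (𝓝[<] 1) (𝓝 (1 - ζ)) := by
      have : Continuous fun t : ℝ => 1 - (t : ℂ) * ζ := by fun_prop
      simpa using (this.tendsto 1).mono_left (nhdsWithin_le_nhds (s := Iio 1))
    exact hc.tendsto.comp h2
  refine tendsto_nhds_unique hlim1 (hlim2.congr' ?_)
  filter_upwards [Ioo_mem_nhdsLT (zero_lt_one' ℝ)] with t ht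
  rw [hmem t ht, hopen]
  rw [norm_mul, Complex.norm_real, Real.norm_of_nonneg ht.1.le]
  exact (mul_le_of_le_one_right ht.1.le hζ).trans_lt ht.2

/-! ### The symbols on the imaginary axis -/

/-- `(1 - e^{-z}) / z` as an entire function. -/
noncomputable def expQuot : ℂ → ℂ := dslope (fun z => -Complex.exp (-z)) 0

lemma analyticAt_expQuot (z : ℂ) : AnalyticAt ℂ expQuot z := by
  have h : DifferentiableOn ℂ expQuot univ :=
    (Complex.differentiableOn_dslope univ_mem).2 (by fun_prop)
  exact h.analyticAt univ_mem

lemma mul_expQuot (z : ℂ) : z * expQuot z = 1 - Complex.exp (-z) := by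
  have := sub_smul_dslope (fun z => -Complex.exp (-z)) 0 z
  simp only [sub_zero, smul_eq_mul, neg_zero, Complex.exp_zero] at this
  rw [expQuot, this]
  ring

lemma hasDerivAt_neg_exp_neg (z : ℂ) :
    HasDerivAt (fun z => -Complex.exp (-z)) (Complex.exp (-z)) z := by
  simpa using ((hasDerivAt_neg z).cexp).fun_neg

lemma expQuot_zero : expQuot 0 = 1 := by
  rw [expQuot, dslope_same, (hasDerivAt_neg_exp_neg 0).deriv]
  simp

lemma hasDerivAt_expQuot_zero : HasDerivAt expQuot (-1 / 2) 0 := by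
  have h1 : AnalyticAt ℂ (fun z => -Complex.exp (-z)) 0 := by fun_prop
  have h2 := h1.hasFPowerSeriesAt.has_fpower_series_dslope_fslope
  have h3 := h2.hasDerivAt
  have hd : deriv (fun z => -Complex.exp (-z)) = fun z => Complex.exp (-z) :=
    funext fun z => (hasDerivAt_neg_exp_neg z).deriv
  have hd2 : deriv (fun z => Complex.exp (-z)) 0 = -1 := by
    simpa using ((hasDerivAt_neg (0 : ℂ)).cexp).deriv
  convert! h3 using 1
  change _ = FormalMultilinearSeries.coeff _ 1
  rw [FormalMultilinearSeries.coeff_fslope,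
    FormalMultilinearSeries.coeff_ofScalars, iteratedDeriv_succ', iteratedDeriv_one, hd, hd2]
  simp

/-- The analytic extension `((1 - e^{-z}) / z)^α e^{rz}` of `w α r` to a complex neighbourhood
of the real axis (the principal power is analytic near `0`, where the base is close to `1`). -/
noncomputable def wExt (α : ℝ) (r : ℤ) (z : ℂ) : ℂ :=
  expQuot z ^ (α : ℂ) * Complex.exp (r * z)

lemma analyticAt_wExt (α : ℝ) (r : ℤ) : AnalyticAt ℂ (wExt α r) 0 := by
  refine ((analyticAt_expQuot 0).cpow analyticAt_const ?_).mul (by fun_prop)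
  rw [expQuot_zero]
  simp

lemma ofReal_w (α : ℝ) (r : ℤ) (x : ℝ) : (w α r x : ℂ) = wExt α r x := by
  by_cases hx : x = 0
  · simp [w, wExt, hx, expQuot_zero]
  · have hq : expQuot x = (((1 - Real.exp (-x)) / x : ℝ) : ℂ) := by
      have hx' : (x : ℂ) ≠ 0 := by exact_mod_cast hx
      apply mul_left_cancel₀ hx'
      rw [mul_expQuot]
      push_cast
      field_simp
    have hpos : 0 ≤ (1 - Real.exp (-x)) / x := by
      rcases lt_or_gt_of_ne hx with h | h
      · refine div_nonneg_of_nonpos ?_ h.le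
        have : 1 ≤ Real.exp (-x) := Real.one_le_exp (by linarith)
        linarith
      · refine div_nonneg ?_ h.le
        have : Real.exp (-x) ≤ 1 := Real.exp_le_one_iff.2 (by linarith)
        linarith
    rw [w, if_neg hx, wExt, hq, ← Complex.ofReal_cpow hpos]
    push_cast
    rfl

/-- The iterated derivatives at a real point of a real function are those of an analytic
extension. -/
lemma eventually_ofReal_iteratedDeriv_eq {f : ℝ → ℝ} {F : ℂ → ℂ} {x₀ : ℝ}
    (hF : AnalyticAt ℂ F x₀) (h : ∀ᶠ x : ℝ in 𝓝 x₀, (f x : ℂ) = F x) (l : ℕ) :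
    ∀ᶠ x : ℝ in 𝓝 x₀, ((iteratedDeriv l f x : ℝ) : ℂ) = iteratedDeriv l F x := by
  induction l with
  | zero => simpa using h
  | succ l ih =>
    have hA : ∀ᶠ x : ℝ in 𝓝 x₀, AnalyticAt ℂ F x :=
      Complex.continuous_ofReal.continuousAt.eventually hF.eventually_analyticAt
    filter_upwards [ih.eventually_nhds, hA] with x hx hAx
    have hd : HasDerivAt (iteratedDeriv l F) (iteratedDeriv (l + 1) F x) x := by
      rw [iteratedDeriv_succ]
      rw [iteratedDeriv_eq_iterate]
      exact (AnalyticAt.iterated_deriv hAx l).differentiableAt.hasDerivAt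
    have hre : HasDerivAt (iteratedDeriv l f) (iteratedDeriv (l + 1) F x).re x := by
      refine hd.real_of_complex.congr_of_eventuallyEq ?_
      filter_upwards [hx] with y hy
      rw [← hy, Complex.ofReal_re]
    have h1 : HasDerivAt (fun y : ℝ => ((iteratedDeriv l f y : ℝ) : ℂ))
        (iteratedDeriv (l + 1) F x) x := hd.comp_ofReal.congr_of_eventuallyEq hx
    rw [iteratedDeriv_succ, hre.deriv]
    exact hre.ofReal_comp.unique h1

lemma ofReal_a (α : ℝ) (r : ℤ) (l : ℕ) :
    (a α r l : ℂ) = iteratedDeriv l (wExt α r) 0 / l.factorial := by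
  have := (eventually_ofReal_iteratedDeriv_eq (x₀ := 0) (f := w α r) (F := wExt α r)
    (by simpa using analyticAt_wExt α r) (Eventually.of_forall (ofReal_w α r)) l).self_of_nhds
  rw [a]
  push_cast
  rw [this, Complex.ofReal_zero]

lemma a_zero (α : ℝ) (r : ℤ) : a α r 0 = 1 := by simp [a, w]

lemma a_one (α : ℝ) (r : ℤ) : a α r 1 = r - α / 2 := by
  have h : HasDerivAt (wExt α r) (r - α / 2 : ℂ) 0 := by
    have h1 := hasDerivAt_expQuot_zero.cpow_const (c := (α : ℂ)) (by rw [expQuot_zero]; simp)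
    have h2 : HasDerivAt (fun z : ℂ => Complex.exp (r * z)) (Complex.exp (r * 0) * (r * 1)) 0 :=
      ((hasDerivAt_id (0 : ℂ)).const_mul (r : ℂ)).cexp
    convert! h1.mul h2 using 1
    simp [expQuot_zero]
    ring
  have h2 := ofReal_a α r 1
  rw [iteratedDeriv_one, h.deriv] at h2
  have h3 : (a α r 1 : ℂ) = ((r - α / 2 : ℝ) : ℂ) := by rw [h2]; simp
  exact_mod_cast h3

lemma c_zero {α : ℝ} {p q : ℤ} (hpq : p ≠ q) : c α p q 0 = 1 := by
  have : (p : ℝ) - q ≠ 0 := sub_ne_zero.2 (by exact_mod_cast hpq)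
  rw [c, a_zero, a_zero, mu1, mu2]
  field_simp
  ring

/-- The weights `mu1`, `mu2` are chosen so that the first order term vanishes. -/
lemma c_one {α : ℝ} {p q : ℤ} (hpq : p ≠ q) : c α p q 1 = 0 := by
  have : (p : ℝ) - q ≠ 0 := sub_ne_zero.2 (by exact_mod_cast hpq)
  rw [c, a_one, a_one, mu1, mu2]
  field_simp
  ring

lemma isBigO_sub_taylor {f : ℂ → ℂ} (hf : AnalyticAt ℂ f 0) (n : ℕ) :
    (fun z => f z - ∑ l ∈ Finset.range n, iteratedDeriv l f 0 / l.factorial * z ^ l)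
      =O[𝓝 0] fun z => z ^ n := by
  have h := hf.hasFPowerSeriesAt.isBigO_sub_partialSum_pow n
  simp only [zero_add, FormalMultilinearSeries.partialSum, ← norm_pow,
    Asymptotics.isBigO_norm_right] at h
  refine h.congr_left fun z => ?_
  congr 1
  refine Finset.sum_congr rfl fun l _ => ?_
  simp [mul_comm]

lemma isBigO_wExt_sub (α : ℝ) (r : ℤ) :
    (fun z => wExt α r z - ∑ l ∈ Finset.range 4, (a α r l : ℂ) * z ^ l) =O[𝓝 0] fun z => z ^ 4 := by
  simpa only [ofReal_a] using isBigO_sub_taylor (analyticAt_wExt α r) 4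

lemma isBigO_weighted_wExt_sub {α : ℝ} {p q : ℤ} (hpq : p ≠ q) :
    (fun z => mu1 α p q * wExt α p z + mu2 α p q * wExt α q z -
      (1 + c α p q 2 * z ^ 2 + c α p q 3 * z ^ 3)) =O[𝓝 0] fun z : ℂ => z ^ 4 := by
  refine (((isBigO_wExt_sub α p).const_mul_left (mu1 α p q : ℂ)).add
    ((isBigO_wExt_sub α q).const_mul_left (mu2 α p q : ℂ))).congr_left fun z => ?_
  have h0 : (mu1 α p q * a α p 0 + mu2 α p q * a α q 0 : ℂ) = 1 := by
    exact_mod_cast c_zero (α := α) hpq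
  have h1 : (mu1 α p q * a α p 1 + mu2 α p q * a α q 1 : ℂ) = 0 := by
    exact_mod_cast c_one (α := α) hpq
  simp only [Finset.sum_range_succ, Finset.sum_range_zero, c]
  push_cast
  linear_combination -h0 - z * h1

lemma isBigO_second_difference_exp :
    (fun z => Complex.exp z - 2 + Complex.exp (-z) - z ^ 2) =O[𝓝 0] fun z : ℂ => z ^ 4 := by
  have hA : AnalyticAt ℂ Complex.exp 0 := by fun_prop
  have h := isBigO_sub_taylor hA 4
  simp only [iteratedDeriv_eq_iterate, Complex.iter_deriv_exp, Complex.exp_zero] at h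
  have hn : Tendsto (fun z : ℂ => -z) (𝓝 0) (𝓝 0) := by
    simpa using (continuous_neg (G := ℂ)).tendsto 0
  have h' := h.comp_tendsto hn
  simp only [Function.comp_def] at h'
  have h'' := h'.congr_right (g₂ := fun z => z ^ 4) fun z => by ring
  refine (h.add h'').congr_left fun z => ?_
  simp only [Finset.sum_range_succ, Finset.sum_range_zero, Nat.factorial]
  push_cast
  ring

/-- Near `0`, the principal branches are compatible on the imaginary axis. -/
lemma eventually_one_sub_exp_neg_cpow (α : ℝ) : ∀ᶠ z in 𝓝 (0 : ℂ), z.re = 0 →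
    (1 - Complex.exp (-z)) ^ (α : ℂ) = z ^ (α : ℂ) * expQuot z ^ (α : ℂ) := by
  have hc : ContinuousAt (fun z => Complex.arg (expQuot z)) 0 :=
    ContinuousAt.comp (Complex.continuousAt_arg (by rw [expQuot_zero]; simp))
      (analyticAt_expQuot 0).continuousAt
  have h1 : ∀ᶠ z in 𝓝 (0 : ℂ), |Complex.arg (expQuot z)| < Real.pi / 2 := by
    refine (hc.abs).eventually_lt continuousAt_const ?_
    rw [expQuot_zero]
    simpa using Real.pi_pos
  have h2 : ∀ᶠ z in 𝓝 (0 : ℂ), expQuot z ≠ 0 :=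
    (analyticAt_expQuot 0).continuousAt.eventually_ne (by rw [expQuot_zero]; simp)
  filter_upwards [h1, h2] with z hz hne hre
  rw [← mul_expQuot]
  by_cases h0 : z = 0
  · subst h0
    by_cases hα : (α : ℂ) = 0
    · simp [hα]
    · simp [Complex.zero_cpow hα]
  · -- `arg z = ±π/2` and `|arg (expQuot z)| < π/2`, so the arguments add up within `(-π, π]`
    have harg : |Complex.arg z| ≤ Real.pi / 2 := Complex.abs_arg_le_pi_div_two_iff.2 hre.ge
    have hmem : Complex.arg z + Complex.arg (expQuot z) ∈ Ioc (-Real.pi) Real.pi := by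
      rw [abs_lt] at hz
      rw [abs_le] at harg
      constructor <;> linarith [hz.1, hz.2, harg.1, harg.2]
    rw [Complex.cpow_def_of_ne_zero (mul_ne_zero h0 hne), Complex.cpow_def_of_ne_zero h0,
      Complex.cpow_def_of_ne_zero hne, Complex.log_mul h0 hne hmem, add_mul, Complex.exp_add]

/-- The symbol of the WSGD operator for step `1`. -/
noncomputable def wsgdSymbol (α : ℝ) (p q : ℤ) (z : ℂ) : ℂ :=
  (mu1 α p q * Complex.exp (p * z) + mu2 α p q * Complex.exp (q * z)) *
    (1 - Complex.exp (-z)) ^ (α : ℂ)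

/-- The symbol of the right-hand side of the expansion for step `1`. -/
noncomputable def expansionSymbol (α : ℝ) (p q : ℤ) (z : ℂ) : ℂ :=
  z ^ (α : ℂ) * (1 + c α p q 2 * (Complex.exp z - 2 + Complex.exp (-z)) + c α p q 3 * z ^ 3)

lemma norm_exp_of_re_eq_zero {z : ℂ} (hz : z.re = 0) : ‖Complex.exp z‖ = 1 := by
  rw [Complex.norm_exp, hz, Real.exp_zero]

lemma eventually_symbol_sub_le {α : ℝ} {p q : ℤ} (hpq : p ≠ q) :
    ∃ C, ∀ᶠ z in 𝓝 (0 : ℂ), z.re = 0 →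
      ‖wsgdSymbol α p q z - expansionSymbol α p q z‖ ≤ C * ‖z‖ ^ α * ‖z‖ ^ 4 := by
  have h := (isBigO_weighted_wExt_sub (α := α) hpq).sub
    (isBigO_second_difference_exp.const_mul_left (c α p q 2 : ℂ))
  obtain ⟨C, hC⟩ := h.bound
  refine ⟨C, ?_⟩
  filter_upwards [hC, eventually_one_sub_exp_neg_cpow α] with z hz hcp hre
  have : wsgdSymbol α p q z - expansionSymbol α p q z = z ^ (α : ℂ) *
      (mu1 α p q * wExt α p z + mu2 α p q * wExt α q z -
      (1 + c α p q 2 * z ^ 2 + c α p q 3 * z ^ 3) -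
      c α p q 2 * (Complex.exp z - 2 + Complex.exp (-z) - z ^ 2)) := by
    rw [wsgdSymbol, expansionSymbol, hcp hre, wExt, wExt]
    ring
  rw [this, norm_mul, Complex.norm_cpow_real]
  rw [norm_pow] at hz
  calc ‖z‖ ^ α * _ ≤ ‖z‖ ^ α * (C * ‖z‖ ^ 4) := by gcongr
    _ = _ := by ring

/-- On the imaginary axis the two symbols differ by `O(|z|^{α+4})`: near `0` by construction of
the coefficients, away from `0` because of trivial growth bounds. -/
lemma norm_symbol_sub_le {α : ℝ} (hα₀ : 0 < α) {p q : ℤ} (hpq : p ≠ q) :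
    ∃ C, 0 ≤ C ∧ ∀ z : ℂ, z.re = 0 →
      ‖wsgdSymbol α p q z - expansionSymbol α p q z‖ ≤ C * ‖z‖ ^ (α + 4) := by
  obtain ⟨C, hC⟩ := eventually_symbol_sub_le (α := α) hpq
  obtain ⟨δ, hδ, hball⟩ := Metric.eventually_nhds_iff.1 hC
  set A := (|mu1 α p q| + |mu2 α p q|) * 2 ^ α with hA
  have hA0 : 0 ≤ A := by positivity
  set B := 1 + |c α p q 2| * 4 with hB
  have hB0 : 0 ≤ B := by positivity
  have hfar : ∀ z : ℂ, z.re = 0 → ‖wsgdSymbol α p q z - expansionSymbol α p q z‖ ≤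
      A + ‖z‖ ^ α * (B + |c α p q 3| * ‖z‖ ^ 3) := by
    intro z hz
    have e1 : ‖Complex.exp z‖ = 1 := norm_exp_of_re_eq_zero hz
    have e2 : ‖Complex.exp (-z)‖ = 1 := norm_exp_of_re_eq_zero (by simp [hz])
    have e3 (r : ℤ) : ‖Complex.exp (r * z)‖ = 1 := norm_exp_of_re_eq_zero (by simp [hz])
    refine (norm_sub_le _ _).trans (add_le_add ?_ ?_)
    · rw [wsgdSymbol, norm_mul, Complex.norm_cpow_real, hA]
      gcongr
      · refine (norm_add_le _ _).trans ?_
        simp [e3]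
      · refine (norm_sub_le _ _).trans ?_
        rw [e2, norm_one]
        norm_num
    · rw [expansionSymbol, norm_mul, Complex.norm_cpow_real]
      gcongr
      refine (norm_add_le _ _).trans (add_le_add ?_ (by simp))
      refine (norm_add_le _ _).trans (add_le_add (by simp) ?_)
      rw [norm_mul, Complex.norm_real, Real.norm_eq_abs]
      gcongr
      refine (norm_add_le _ _).trans ?_
      refine (add_le_add_left (norm_sub_le _ _) _).trans ?_
      rw [e1, e2]
      norm_num
  refine ⟨|C| + (A / δ ^ (α + 4) + B / δ ^ 4 + |c α p q 3| / δ), by positivity, fun z hz => ?_⟩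
  by_cases hzδ : ‖z‖ < δ
  · have h := hball (y := z) (by simpa using hzδ) hz
    have hpow : ‖z‖ ^ (α + 4) = ‖z‖ ^ α * ‖z‖ ^ 4 := by
      rw [Real.rpow_add_of_nonneg (norm_nonneg _) hα₀.le (by norm_num)]
      norm_cast
    calc _ ≤ C * ‖z‖ ^ α * ‖z‖ ^ 4 := h
      _ ≤ |C| * (‖z‖ ^ α * ‖z‖ ^ 4) := by
        rw [mul_assoc]; gcongr; exact le_abs_self C
      _ ≤ _ := by
        rw [hpow]
        gcongr
        have : 0 ≤ A / δ ^ (α + 4) + B / δ ^ 4 + |c α p q 3| / δ := by positivity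
        linarith
  · push Not at hzδ
    have hz0 : 0 < ‖z‖ := hδ.trans_le hzδ
    have hpow : ‖z‖ ^ (α + 4) = ‖z‖ ^ α * ‖z‖ ^ 4 := by
      rw [Real.rpow_add hz0]
      norm_cast
    have t1 : A ≤ A / δ ^ (α + 4) * ‖z‖ ^ (α + 4) := by
      rw [div_mul_eq_mul_div, le_div_iff₀ (by positivity)]
      gcongr
    have t2 : B ≤ B / δ ^ 4 * ‖z‖ ^ 4 := by
      rw [div_mul_eq_mul_div, le_div_iff₀ (by positivity)]
      gcongr
    have t3 : |c α p q 3| * ‖z‖ ^ 3 ≤ |c α p q 3| / δ * ‖z‖ ^ 4 := by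
      rw [div_mul_eq_mul_div, le_div_iff₀ (by positivity), pow_succ ‖z‖ 3, ← mul_assoc]
      gcongr
    calc _ ≤ A + ‖z‖ ^ α * (B + |c α p q 3| * ‖z‖ ^ 3) := hfar z hz
      _ ≤ A / δ ^ (α + 4) * ‖z‖ ^ (α + 4) +
          ‖z‖ ^ α * (B / δ ^ 4 * ‖z‖ ^ 4 + |c α p q 3| / δ * ‖z‖ ^ 4) := by gcongr
      _ = (A / δ ^ (α + 4) + B / δ ^ 4 + |c α p q 3| / δ) * ‖z‖ ^ (α + 4) := by
        rw [hpow]; ring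
      _ ≤ _ := mul_le_mul_of_nonneg_right (le_add_of_nonneg_left (abs_nonneg C)) (by positivity)

/-! ### Fourier multipliers -/

/-- The imaginary frequency `2πik`. -/
noncomputable def freq (k : ℝ) : ℂ := 2 * Real.pi * Complex.I * k

lemma freq_eq_ofReal_mul_I (k : ℝ) : freq k = ((2 * Real.pi * k : ℝ) : ℂ) * Complex.I := by
  rw [freq]; push_cast; ring

@[simp] lemma freq_re (k : ℝ) : (freq k).re = 0 := by rw [freq_eq_ofReal_mul_I]; simp

@[fun_prop] lemma continuous_freq : Continuous freq := by unfold freq; fun_prop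

lemma norm_freq (k : ℝ) : ‖freq k‖ = 2 * Real.pi * |k| := by
  rw [freq_eq_ofReal_mul_I, norm_mul, Complex.norm_real, Complex.norm_I, Real.norm_eq_abs, abs_mul,
    abs_of_pos (by positivity : (0 : ℝ) < 2 * Real.pi), mul_one]

lemma freq_ne_zero {k : ℝ} (hk : k ≠ 0) : freq k ≠ 0 := by
  rw [← norm_ne_zero_iff, norm_freq]
  positivity

lemma norm_exp_freq_mul (k x : ℝ) : ‖Complex.exp (freq k * x)‖ = 1 :=
  norm_exp_of_re_eq_zero (by simp)

lemma fourierInv_eq_integral (f : ℝ → ℂ) (x : ℝ) :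
    𝓕⁻ f x = ∫ k, Complex.exp (freq k * x) * f k := by
  rw [Real.fourierInv_eq']
  refine integral_congr_ae (Eventually.of_forall fun k => ?_)
  simp only [smul_eq_mul, freq, RCLike.inner_apply, conj_trivial]
  congr 2
  push_cast
  ring

lemma integrable_exp_freq_mul {f : ℝ → ℂ} (hf : Integrable f) (x : ℝ) :
    Integrable fun k => Complex.exp (freq k * x) * f k := by
  refine hf.bdd_mul (c := 1) ?_ (Eventually.of_forall fun k => (norm_exp_freq_mul k x).le)
  exact Continuous.aestronglyMeasurable (by fun_prop)

lemma norm_fourierInv_le (f : ℝ → ℂ) (x : ℝ) : ‖𝓕⁻ f x‖ ≤ ∫ k, ‖f k‖ := by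
  rw [fourierInv_eq_integral]
  refine (norm_integral_le_integral_norm _).trans_eq ?_
  simp only [norm_mul, norm_exp_freq_mul, one_mul]

/-- Derivatives of an inverse Fourier transform. -/
lemma contDiff_fourierInv {f : ℝ → ℂ} {n : ℕ}
    (hf : ∀ j ≤ n, Integrable fun k => freq k ^ j * f k) :
    ContDiff ℝ n (𝓕⁻ f) ∧ ∀ x, iteratedDeriv n (𝓕⁻ f) x = 𝓕⁻ (fun k => freq k ^ n * f k) x := by
  have hfun : 𝓕⁻ f = fun x => 𝓕 f (-x) := funext fun x => Real.fourierInv_eq_fourier_neg f x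
  have h1 : ∀ j : ℕ, (j : ℕ∞) ≤ (n : ℕ∞) → Integrable fun k : ℝ => k ^ j • f k := by
    intro j hj
    have := (hf j (by exact_mod_cast hj)).const_mul ((2 * Real.pi * Complex.I)⁻¹ ^ j)
    refine this.congr (Eventually.of_forall fun k => ?_)
    have hne : (2 * Real.pi * Complex.I : ℂ) ≠ 0 := Complex.two_pi_I_ne_zero
    simp only [freq, Complex.real_smul, Complex.ofReal_pow]
    rw [mul_pow _ (k : ℂ), inv_pow]
    field_simp
  have h2 : ∀ j : ℕ, (j : ℕ∞) ≤ (n : ℕ∞) → Integrable fun k : ℝ => ‖k‖ ^ j * ‖f k‖ := by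
    intro j hj
    simpa [norm_smul] using (h1 j hj).norm
  constructor
  · rw [hfun]
    exact (Real.contDiff_fourier (N := (n : ℕ∞)) h2).comp contDiff_neg
  · intro x
    rw [hfun, iteratedDeriv_comp_neg, Real.iteratedDeriv_fourier h1 le_rfl,
      Real.fourierInv_eq_fourier_neg, Real.fourier_eq, Real.fourier_eq, ← integral_smul]
    refine integral_congr_ae (Eventually.of_forall fun k => ?_)
    simp only [smul_comm _ (_ : Circle)]
    congr 1
    rw [freq, smul_eq_mul, Complex.real_smul]
    push_cast
    rw [← mul_assoc, ← mul_pow]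
    congr 2
    ring

/-- The complex-valued Fourier transform of a real function. -/
noncomputable def hat (u : ℝ → ℝ) : ℝ → ℂ := 𝓕 fun x => (u x : ℂ)

lemma norm_hat_le (u : ℝ → ℝ) (k : ℝ) : ‖hat u k‖ ≤ ∫ x, |u x| := by
  refine (VectorFourier.norm_fourierIntegral_le_integral_norm _ _ _ _ _).trans_eq ?_
  simp

section Decay

variable {u : ℝ → ℝ} (hu : ContDiff ℝ 7 u)
  (hu_int : ∀ k : ℕ, k ≤ 7 → Integrable (iteratedDeriv k u))

include hu_int in
lemma integrable_of_iteratedDeriv : Integrable u := by simpa using hu_int 0 (by norm_num)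

include hu_int in
lemma continuous_hat : Continuous (hat u) :=
  VectorFourier.fourierIntegral_continuous Real.continuous_fourierChar (by fun_prop)
    (integrable_of_iteratedDeriv hu_int).ofReal

include hu hu_int in
lemma hat_iteratedDeriv {n : ℕ} (hn : n ≤ 7) (k : ℝ) :
    hat (iteratedDeriv n u) k = freq k ^ n * hat u k := by
  have hcd : ∀ {m : ℕ}, m ≤ 7 → ContDiff ℝ m u := fun hm => hu.of_le (by exact_mod_cast hm)
  have hfun : ∀ {m : ℕ}, m ≤ 7 → iteratedDeriv m (fun x => (u x : ℂ)) =
      fun x => ((iteratedDeriv m u x : ℝ) : ℂ) := fun hm =>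
    funext fun x => iteratedDeriv_ofReal_comp (hcd hm) x
  have h := Real.fourier_iteratedDeriv (f := fun x => (u x : ℂ)) (N := 7) (n := n)
    (Complex.ofRealCLM.contDiff.comp hu) (fun m hm => by
      rw [hfun (by exact_mod_cast hm)]
      exact (hu_int m (by exact_mod_cast hm)).ofReal) (by exact_mod_cast hn)
  rw [hfun hn] at h
  rw [hat, h]
  simp [freq, hat]

include hu hu_int in
lemma exists_decay_hat : ∃ C, 0 ≤ C ∧ ∀ k, ‖hat u k‖ ≤ C ∧ |k| ^ 7 * ‖hat u k‖ ≤ C := by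
  refine ⟨max (∫ x, |u x|) (∫ x, |iteratedDeriv 7 u x|),
    le_max_of_le_left (integral_nonneg fun _ => abs_nonneg _), fun k => ⟨?_, ?_⟩⟩
  · exact (norm_hat_le u k).trans (le_max_left _ _)
  · refine le_trans ?_ ((norm_hat_le (iteratedDeriv 7 u) k).trans (le_max_right _ _))
    rw [hat_iteratedDeriv hu hu_int le_rfl, norm_mul, norm_pow, norm_freq]
    gcongr
    refine le_mul_of_one_le_left (abs_nonneg _) ?_
    linarith [Real.pi_gt_three]

lemma integrable_of_comp_abs {f : ℝ → ℝ} (hf : IntegrableOn f (Ioi 0)) :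
    Integrable fun x => f |x| := by
  rw [← integrableOn_univ, ← Iio_union_Ici (a := (0 : ℝ)), integrableOn_union]
  constructor
  · have h := hf.comp_neg
    rw [Set.neg_Ioi, neg_zero] at h
    refine h.congr_fun (fun x hx => ?_) measurableSet_Iio
    simp only [abs_of_neg (mem_Iio.1 hx)]
  · rw [integrableOn_Ici_iff_integrableOn_Ioi]
    refine hf.congr_fun (fun x hx => ?_) measurableSet_Ioi
    simp only [abs_of_pos (mem_Ioi.1 hx)]

include hu hu_int in
lemma integrable_norm_freq_rpow_mul_hat {γ : ℝ} (h1 : -1 < γ) (h2 : γ < 6) :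
    Integrable fun k => ‖freq k‖ ^ γ * ‖hat u k‖ := by
  obtain ⟨C, hC0, hC⟩ := exists_decay_hat hu hu_int
  -- `|û|` is bounded near the origin and `O(|k|^{-7})` at infinity
  set b : ℝ → ℝ := fun t => if t ≤ 1 then t ^ γ else t ^ (γ - 7) with hb
  have hbint : IntegrableOn b (Ioi 0) := by
    rw [← Ioc_union_Ioi_eq_Ioi zero_le_one, integrableOn_union]
    constructor
    · rw [integrableOn_Ioc_iff_integrableOn_Ioo]
      refine ((intervalIntegral.integrableOn_Ioo_rpow_iff zero_lt_one).2 h1).congr_fun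
        (fun t ht => ?_) measurableSet_Ioo
      simp only [hb, if_pos ht.2.le]
    · refine (integrableOn_Ioi_rpow_of_lt (by linarith : γ - 7 < -1) zero_lt_one).congr_fun
        (fun t ht => ?_) measurableSet_Ioi
      simp only [hb, if_neg (not_le.2 (mem_Ioi.1 ht))]
  have hmeas : AEStronglyMeasurable (fun k => ‖freq k‖ ^ γ * ‖hat u k‖) volume := by
    have := (continuous_hat hu_int).measurable
    exact Measurable.aestronglyMeasurable (by fun_prop)
  refine ((integrable_of_comp_abs hbint).const_mul ((2 * Real.pi) ^ γ * C)).mono' hmeas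
    (Eventually.of_forall fun k => ?_)
  rw [Real.norm_of_nonneg (by positivity), norm_freq, Real.mul_rpow (by positivity) (abs_nonneg k),
    mul_assoc, mul_assoc]
  refine mul_le_mul_of_nonneg_left ?_ (by positivity)
  simp only [hb]
  split_ifs with hk
  · rw [mul_comm]
    gcongr
    exact (hC k).1
  · push Not at hk
    have hk0 : 0 < |k| := by linarith
    have : |k| ^ γ = |k| ^ (γ - 7) * |k| ^ 7 := by
      rw [← Real.rpow_natCast, ← Real.rpow_add hk0]
      norm_num
    rw [this, mul_assoc, mul_comm C]
    gcongr
    exact (hC k).2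

include hu hu_int in
/-- Integrability of `m û` for a multiplier `m` of growth `|k|^γ`, `-1 < γ < 6`. -/
lemma integrable_mul_hat {m : ℝ → ℂ} (hm : Measurable m) {A γ : ℝ} (h1 : -1 < γ) (h2 : γ < 6)
    (hA : ∀ k, ‖m k‖ ≤ A * ‖freq k‖ ^ γ) : Integrable fun k => m k * hat u k := by
  have hmeas : AEStronglyMeasurable (fun k => m k * hat u k) volume := by
    have := (continuous_hat hu_int).measurable
    exact Measurable.aestronglyMeasurable (by fun_prop)
  refine ((integrable_norm_freq_rpow_mul_hat hu hu_int h1 h2).const_mul A).mono' hmeas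
    (Eventually.of_forall fun k => ?_)
  rw [norm_mul, ← mul_assoc]
  gcongr
  exact hA k

include hu hu_int in
lemma integrable_freq_cpow_mul_hat {γ : ℝ} (h1 : -1 < γ) (h2 : γ < 6) :
    Integrable fun k => freq k ^ (γ : ℂ) * hat u k :=
  integrable_mul_hat hu hu_int (by fun_prop) (A := 1) h1 h2 fun k => by
    rw [Complex.norm_cpow_real, one_mul]

include hu hu_int in
lemma integrable_hat : Integrable (hat u) := by
  simpa using integrable_freq_cpow_mul_hat hu hu_int (γ := 0) (by norm_num) (by norm_num)

include hu hu_int in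
lemma fourierInv_hat (x : ℝ) : 𝓕⁻ (hat u) x = u x := by
  have h := Continuous.fourierInv_fourier_eq (f := fun x => (u x : ℂ))
    (Complex.continuous_ofReal.comp hu.continuous) (integrable_of_iteratedDeriv hu_int).ofReal
    (integrable_hat hu hu_int)
  exact congrFun h x

include hu hu_int in
lemma exists_bound : ∃ M, ∀ x, |u x| ≤ M := by
  refine ⟨∫ k, ‖hat u k‖, fun x => ?_⟩
  rw [← Real.norm_eq_abs, ← Complex.norm_real, ← fourierInv_hat hu hu_int]
  exact norm_fourierInv_le _ _

end Decay

/-! ### Riemann–Liouville derivatives as Fourier multipliers -/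

lemma measurePreserving_sub_left (x : ℝ) : MeasurePreserving (fun t : ℝ => x - t) volume volume :=
  Measure.measurePreserving_sub_left volume x

lemma preimage_sub_left_Iio (x : ℝ) : (fun t : ℝ => x - t) ⁻¹' Iio x = Ioi 0 := by
  ext t; simp

lemma leftKernelIntegral_eq (s : ℝ) (u : ℝ → ℝ) (x : ℝ) :
    leftKernelIntegral s u x = ∫ t in Ioi 0, t ^ (-s) * u (x - t) := by
  have h := (measurePreserving_sub_left x).setIntegral_preimage_emb
    (Homeomorph.subLeft x).measurableEmbedding (fun ξ => u ξ / (x - ξ) ^ s) (Iio x)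
  rw [leftKernelIntegral, ← h, preimage_sub_left_Iio]
  refine setIntegral_congr_fun measurableSet_Ioi fun t ht => ?_
  simp only [sub_sub_cancel]
  rw [Real.rpow_neg (le_of_lt ht), div_eq_mul_inv, mul_comm]

lemma integrableOn_leftKernel_iff (s : ℝ) (u : ℝ → ℝ) (x : ℝ) :
    IntegrableOn (fun ξ => u ξ / (x - ξ) ^ s) (Iio x) ↔
      IntegrableOn (fun t => t ^ (-s) * u (x - t)) (Ioi 0) := by
  rw [← (measurePreserving_sub_left x).integrableOn_comp_preimage
    (Homeomorph.subLeft x).measurableEmbedding, preimage_sub_left_Iio]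
  refine integrableOn_congr_fun (fun t ht => ?_) measurableSet_Ioi
  simp only [Function.comp_apply, sub_sub_cancel]
  rw [Real.rpow_neg (le_of_lt ht), div_eq_mul_inv, mul_comm]

section Kernel

variable {u : ℝ → ℝ} (hu : ContDiff ℝ 7 u)
  (hu_int : ∀ k : ℕ, k ≤ 7 → Integrable (iteratedDeriv k u)) {s : ℝ} (hs1 : s < 1)

include hu hu_int hs1

/-- Absolute convergence of the kernel integral: `u` is bounded near the singularity `t = 0`, and
integrable where the kernel is at most `1`. -/
lemma integrableOn_rpow_mul_comp_sub (hs0 : 0 < s) (x : ℝ) :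
    IntegrableOn (fun t => t ^ (-s) * u (x - t)) (Ioi 0) := by
  obtain ⟨M, hM⟩ := exists_bound hu hu_int
  have hc := hu.continuous
  have hmeas (μ : Measure ℝ) : AEStronglyMeasurable (fun t => t ^ (-s) * u (x - t)) μ := by
    have := hc.measurable
    exact Measurable.aestronglyMeasurable (by fun_prop)
  rw [← Ioc_union_Ioi_eq_Ioi zero_le_one, integrableOn_union]
  constructor
  · have h1 : IntegrableOn (fun t : ℝ => t ^ (-s)) (Ioc 0 1) := by
      rw [integrableOn_Ioc_iff_integrableOn_Ioo]
      exact (intervalIntegral.integrableOn_Ioo_rpow_iff zero_lt_one).2 (by linarith)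
    refine (h1.mul_const M).mono' (hmeas _) ?_
    filter_upwards [ae_restrict_mem measurableSet_Ioc] with t ht
    have ht0 : 0 < t := ht.1
    rw [norm_mul, Real.norm_of_nonneg (by positivity)]
    gcongr
    exact hM _
  · have h2 : Integrable fun t => u (x - t) := (integrable_of_iteratedDeriv hu_int).comp_sub_left x
    refine h2.norm.integrableOn.mono' (hmeas _) ?_
    filter_upwards [ae_restrict_mem measurableSet_Ioi] with t ht
    have ht1 : (1 : ℝ) < t := ht
    rw [norm_mul, Real.norm_of_nonneg (by positivity)]
    exact mul_le_of_le_one_left (norm_nonneg _)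
      (Real.rpow_le_one_of_one_le_of_nonpos ht1.le (by linarith))

/-- With the convergence factor `e^{-εt}`, Fubini's theorem evaluates the kernel integral. -/
lemma integral_rpow_mul_exp_mul_comp_sub {ε : ℝ} (hε : 0 < ε) (x : ℝ) :
    ∫ t in Ioi (0 : ℝ), ((t ^ (-s) : ℝ) : ℂ) * Complex.exp (-(ε * t)) * (u (x - t) : ℂ) =
      ∫ k, Real.Gamma (1 - s) * (ε + freq k) ^ ((s - 1 : ℝ) : ℂ) *
        (Complex.exp (freq k * x) * hat u k) := by
  have hU := integrable_exp_freq_mul (integrable_hat hu hu_int) x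
  have hT := integrableOn_rpow_mul_cexp (b := -s) (r := ε) (by linarith) (by simpa using hε)
  have hprod : Integrable (Function.uncurry fun (t k : ℝ) =>
      Complex.exp (-(freq k * t)) * ((((t ^ (-s) : ℝ) : ℂ) * Complex.exp (-(ε * t))) *
        (Complex.exp (freq k * x) * hat u k))) ((volume.restrict (Ioi 0)).prod volume) := by
    refine (hT.integrable.mul_prod hU).bdd_mul (c := 1)
      (Continuous.aestronglyMeasurable (by fun_prop)) (Eventually.of_forall fun p => ?_)
    exact (norm_exp_of_re_eq_zero (by simp)).le
  calc _ = ∫ t in Ioi (0 : ℝ), ∫ k, Complex.exp (-(freq k * t)) *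
        ((((t ^ (-s) : ℝ) : ℂ) * Complex.exp (-(ε * t))) *
          (Complex.exp (freq k * x) * hat u k)) := by
        refine integral_congr_ae (Eventually.of_forall fun t => ?_)
        simp only
        rw [← fourierInv_hat hu hu_int, fourierInv_eq_integral, ← integral_const_mul]
        refine integral_congr_ae (Eventually.of_forall fun k => ?_)
        simp only
        rw [show freq k * ((x - t : ℝ) : ℂ) = freq k * x + -(freq k * t) by push_cast; ring,
          Complex.exp_add]
        ring
    _ = ∫ k, ∫ t in Ioi (0 : ℝ), Complex.exp (-(freq k * t)) *
        ((((t ^ (-s) : ℝ) : ℂ) * Complex.exp (-(ε * t))) *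
          (Complex.exp (freq k * x) * hat u k)) := integral_integral_swap hprod
    _ = _ := by
        refine integral_congr_ae (Eventually.of_forall fun k => ?_)
        simp only
        have h := integral_rpow_mul_cexp (a := 1 - s) (r := ε + freq k) (by linarith)
          (by simpa using hε)
        rw [show -((1 - s : ℝ) : ℂ) = ((s - 1 : ℝ) : ℂ) by push_cast; ring] at h
        rw [← h, ← integral_mul_const]
        refine integral_congr_ae (Eventually.of_forall fun t => ?_)
        simp only
        rw [show -((ε + freq k) * t) = -(freq k * t) + -(ε * t : ℂ) by ring, Complex.exp_add,
          show 1 - s - 1 = -s by ring]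
        ring

/-- The kernel integral is the Fourier multiplier `Γ(1 - s) (2πik)^{s-1}`. The symbol is unbounded
at `k = 0` and the kernel not integrable at infinity, so the identity is obtained as the limit
`ε → 0` of the one with the convergence factor. -/
lemma ofReal_leftKernelIntegral (hs0 : 0 < s) (x : ℝ) :
    (leftKernelIntegral s u x : ℂ) =
      𝓕⁻ (fun k => Real.Gamma (1 - s) * (freq k ^ ((s - 1 : ℝ) : ℂ) * hat u k)) x := by
  set ε : ℕ → ℝ := fun n => 1 / ((n : ℝ) + 1) with hε
  have hεpos : ∀ n, 0 < ε n := fun n => by positivity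
  have hεlim : Tendsto ε atTop (𝓝 0) := tendsto_one_div_add_atTop_nhds_zero_nat
  have hεlim' : Tendsto (fun n => (ε n : ℂ)) atTop (𝓝 0) := by
    simpa [Function.comp_def] using (Complex.continuous_ofReal.tendsto 0).comp hεlim
  have hint := integrableOn_rpow_mul_comp_sub hu hu_int hs1 hs0 x
  have hc := hu.continuous.measurable
  have hch := (continuous_hat hu_int).measurable
  have hleft : Tendsto (fun n => ∫ t in Ioi (0 : ℝ),
      ((t ^ (-s) : ℝ) : ℂ) * Complex.exp (-(ε n * t)) * (u (x - t) : ℂ)) atTop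
      (𝓝 (∫ t in Ioi (0 : ℝ), ((t ^ (-s) * u (x - t) : ℝ) : ℂ))) := by
    refine tendsto_integral_filter_of_dominated_convergence (fun t => ‖t ^ (-s) * u (x - t)‖)
      (Eventually.of_forall fun n => Measurable.aestronglyMeasurable (by fun_prop))
      (Eventually.of_forall fun n => ?_) hint.norm (Eventually.of_forall fun t => ?_)
    · filter_upwards [ae_restrict_mem measurableSet_Ioi] with t ht
      have ht0 : (0 : ℝ) < t := ht
      rw [norm_mul, norm_mul, norm_mul, Complex.norm_real, Complex.norm_real]
      gcongr
      refine mul_le_of_le_one_right (norm_nonneg _) ?_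
      rw [Complex.norm_exp]
      simpa using mul_nonneg (hεpos n).le ht0.le
    · have h : Tendsto (fun n => Complex.exp (-((ε n : ℂ) * t))) atTop (𝓝 1) := by
        have : Continuous fun w : ℂ => Complex.exp (-(w * t)) := by fun_prop
        simpa [Function.comp_def] using (this.tendsto 0).comp hεlim'
      have h2 := (h.const_mul ((t ^ (-s) : ℝ) : ℂ)).mul_const (u (x - t) : ℂ)
      simpa using h2
  have hright : Tendsto (fun n => ∫ k, Real.Gamma (1 - s) *
      (ε n + freq k) ^ ((s - 1 : ℝ) : ℂ) * (Complex.exp (freq k * x) * hat u k)) atTop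
      (𝓝 (∫ k, Real.Gamma (1 - s) * freq k ^ ((s - 1 : ℝ) : ℂ) *
        (Complex.exp (freq k * x) * hat u k))) := by
    refine tendsto_integral_filter_of_dominated_convergence
      (fun k => |Real.Gamma (1 - s)| * (‖freq k‖ ^ (s - 1) * ‖hat u k‖))
      (Eventually.of_forall fun n => Measurable.aestronglyMeasurable (by fun_prop))
      (Eventually.of_forall fun n => ?_)
      ((integrable_norm_freq_rpow_mul_hat hu hu_int (by linarith) (by linarith)).const_mul _) ?_
    · filter_upwards [compl_mem_ae_iff.2 (measure_singleton (0 : ℝ))] with k hk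
      have hk0 : k ≠ 0 := hk
      rw [norm_mul, norm_mul, norm_mul, norm_exp_freq_mul, one_mul, Complex.norm_real,
        Complex.norm_cpow_real, Real.norm_eq_abs, mul_assoc]
      gcongr ?_ * (?_ * ?_)
      -- the exponent is negative, and `|ε + 2πik| ≥ |2πk|`
      refine Real.rpow_le_rpow_of_nonpos (norm_pos_iff.2 (freq_ne_zero hk0)) ?_ (by linarith)
      have h1 : |(freq k).im| ≤ ‖(ε n : ℂ) + freq k‖ := by
        simpa using Complex.abs_im_le_norm ((ε n : ℂ) + freq k)
      refine le_trans (le_of_eq ?_) h1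
      rw [norm_freq, freq_eq_ofReal_mul_I]
      simp [abs_mul, abs_of_pos Real.pi_pos]
    · filter_upwards [compl_mem_ae_iff.2 (measure_singleton (0 : ℝ))] with k hk
      have hk0 : k ≠ 0 := hk
      have hslit : freq k ∈ Complex.slitPlane := by
        refine Or.inr ?_
        rw [freq_eq_ofReal_mul_I]
        simpa using hk0
      have h1 : Tendsto (fun n => (ε n : ℂ) + freq k) atTop (𝓝 (freq k)) := by
        simpa using hεlim'.add_const (freq k)
      exact (((continuousAt_cpow_const hslit).tendsto.comp h1).const_mul _).mul_const _
  have heq := fun n => integral_rpow_mul_exp_mul_comp_sub hu hu_int hs1 (hεpos n) x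
  rw [leftKernelIntegral_eq, ← integral_complex_ofReal]
  refine (tendsto_nhds_unique (hleft.congr heq) hright).trans ?_
  rw [fourierInv_eq_integral]
  refine integral_congr_ae (Eventually.of_forall fun k => ?_)
  simp only
  ring

end Kernel

lemma contDiff_of_ofReal {f : ℝ → ℝ} {n : ℕ} (h : ContDiff ℝ n fun x => (f x : ℂ)) :
    ContDiff ℝ n f := by
  simpa [Function.comp_def] using Complex.reCLM.contDiff.comp h

section Derivative

variable {u : ℝ → ℝ} (hu : ContDiff ℝ 7 u)
  (hu_int : ∀ k : ℕ, k ≤ 7 → Integrable (iteratedDeriv k u)) {β : ℝ} (hβ0 : 0 < β) (hβ5 : β ≤ 5)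

include hu hu_int hβ0 hβ5

/-- The Riemann–Liouville derivative of order `0 < β ≤ 5` exists and is the Fourier multiplier
with symbol `(2πik)^β`. -/
lemma leftRLExists_and_eq_fourierInv : LeftRLExists β u ∧
    ∀ x, (leftRL β u x : ℂ) = 𝓕⁻ (fun k => freq k ^ (β : ℂ) * hat u k) x := by
  set n := ⌈β⌉₊ with hn
  have hnβ : β ≤ n := Nat.le_ceil β
  have hβn : (n : ℝ) < β + 1 := Nat.ceil_lt_add_one hβ0.le
  have hn5 : n ≤ 5 := Nat.ceil_le.2 (by exact_mod_cast hβ5)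
  have hn5' : (n : ℝ) ≤ 5 := by exact_mod_cast hn5
  by_cases h : β = (n : ℝ)
  · refine ⟨⟨fun _ => hu.of_le (by exact_mod_cast hn5.trans (by norm_num)),
      fun h' => absurd h h'⟩, fun x => ?_⟩
    have hcd := contDiff_fourierInv (f := hat u) (n := n) fun j hj => by
      have hj5 : (j : ℝ) ≤ 5 := le_trans (by exact_mod_cast hj) hn5'
      have := integrable_freq_cpow_mul_hat hu hu_int (γ := j)
        (by have := j.cast_nonneg (α := ℝ); linarith) (by linarith)
      simpa using this
    have hfun : 𝓕⁻ (hat u) = fun x => (u x : ℂ) := funext fun x => fourierInv_hat hu hu_int x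
    rw [leftRL, if_pos h, ← hn, ← iteratedDeriv_ofReal_comp
      (hu.of_le (by exact_mod_cast hn5.trans (by norm_num))), ← hfun, hcd.2]
    simp [h]
  · have hlt : β < n := lt_of_le_of_ne hnβ h
    set s := β - n + 1 with hs
    have hs0 : 0 < s := by linarith
    have hs1 : s < 1 := by linarith
    have hΓ : Real.Gamma (n - β) ≠ 0 := (Real.Gamma_pos_of_pos (by linarith)).ne'
    have hfun : 𝓕⁻ (fun k => Real.Gamma (1 - s) * (freq k ^ ((s - 1 : ℝ) : ℂ) * hat u k)) =
        fun x => (leftKernelIntegral s u x : ℂ) :=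
      funext fun x => (ofReal_leftKernelIntegral hu hu_int hs1 hs0 x).symm
    have hmul (j : ℕ) {k : ℝ} (hk : k ≠ 0) : freq k ^ j * freq k ^ ((s - 1 : ℝ) : ℂ) =
        freq k ^ ((s - 1 + j : ℝ) : ℂ) := by
      rw [Complex.ofReal_add, Complex.cpow_add _ _ (freq_ne_zero hk), mul_comm,
        Complex.ofReal_natCast, Complex.cpow_natCast]
    have hae : ∀ᵐ k : ℝ, k ≠ 0 := compl_mem_ae_iff.2 (measure_singleton (0 : ℝ))
    have hcd := contDiff_fourierInv (n := n)
      (f := fun k => Real.Gamma (1 - s) * (freq k ^ ((s - 1 : ℝ) : ℂ) * hat u k)) fun j hj => by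
        have hj5 : (j : ℝ) ≤ 5 := le_trans (by exact_mod_cast hj) hn5'
        have := (integrable_freq_cpow_mul_hat hu hu_int (γ := s - 1 + j)
          (by have := j.cast_nonneg (α := ℝ); linarith) (by linarith)).const_mul
            (Real.Gamma (1 - s) : ℂ)
        refine this.congr ?_
        filter_upwards [hae] with k hk
        rw [← hmul j hk]
        ring
    rw [hfun] at hcd
    have hcdR : ContDiff ℝ n (leftKernelIntegral s u) := contDiff_of_ofReal hcd.1
    refine ⟨⟨fun h' => absurd h' h, fun _ => ⟨fun x => ?_, hcdR⟩⟩, fun x => ?_⟩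
    · exact (integrableOn_leftKernel_iff s u x).2
        (integrableOn_rpow_mul_comp_sub hu hu_int hs1 hs0 x)
    · rw [leftRL, if_neg h, ← hn, ← hs]
      rw [Complex.ofReal_mul, ← iteratedDeriv_ofReal_comp hcdR, hcd.2, fourierInv_eq_integral,
        fourierInv_eq_integral, ← integral_const_mul]
      refine integral_congr_ae ?_
      filter_upwards [hae] with k hk
      have e1 : s - 1 + n = β := by rw [hs]; ring
      have e2 : 1 - s = n - β := by rw [hs]; ring
      have h3 := hmul n hk
      rw [e1] at h3
      rw [← h3, e2]
      have hΓ' : (Real.Gamma (n - β) : ℂ) ≠ 0 := by exact_mod_cast hΓ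
      push_cast
      field_simp

lemma exists_bound_leftRL : ∃ M, ∀ x, |leftRL β u x| ≤ M := by
  refine ⟨∫ k, ‖freq k ^ (β : ℂ) * hat u k‖, fun x => ?_⟩
  rw [← Real.norm_eq_abs, ← Complex.norm_real,
    (leftRLExists_and_eq_fourierInv hu hu_int hβ0 hβ5).2]
  exact norm_fourierInv_le _ _

end Derivative

/-! ### The WSGD operator as a Fourier multiplier -/

lemma leftTerm_bound {α : ℝ} {p q : ℤ} {u : ℝ → ℝ} {M : ℝ} (hM : ∀ x, |u x| ≤ M) (h x : ℝ)
    (k : ℕ) : ‖leftTerm α p q u h x k‖ ≤ |g α k| * ((|mu1 α p q| + |mu2 α p q|) * M) := by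
  rw [leftTerm, norm_mul, Real.norm_eq_abs, Real.norm_eq_abs, add_mul]
  gcongr
  refine (abs_add_le _ _).trans ?_
  rw [abs_mul, abs_mul]
  gcongr <;> exact hM _

lemma summable_leftTerm {α : ℝ} (hα₀ : 0 < α) (hα₂ : α ≤ 2) (p q : ℤ) {u : ℝ → ℝ} {M : ℝ}
    (hM : ∀ x, |u x| ≤ M) (h x : ℝ) : Summable (leftTerm α p q u h x) :=
  Summable.of_norm_bounded ((summable_abs_g hα₀ hα₂).mul_right _) (leftTerm_bound hM h x)

lemma mul_ofReal_cpow {α : ℝ} (hα₀ : 0 < α) {h : ℝ} (hh : 0 < h) (z : ℂ) :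
    (z * h) ^ (α : ℂ) = z ^ (α : ℂ) * ((h ^ α : ℝ) : ℂ) := by
  have hh' : (h : ℂ) ≠ 0 := by exact_mod_cast hh.ne'
  have hα : (α : ℂ) ≠ 0 := by exact_mod_cast hα₀.ne'
  by_cases hz : z = 0
  · simp [hz, Complex.zero_cpow hα]
  · rw [Complex.ofReal_cpow hh.le, Complex.cpow_def_of_ne_zero (mul_ne_zero hz hh'),
      Complex.cpow_def_of_ne_zero hz, Complex.cpow_def_of_ne_zero hh',
      Complex.log_mul_ofReal h hh z hz, ← Complex.ofReal_log hh.le, ← Complex.exp_add]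
    ring_nf

lemma integral_linear_combination {f₁ f₂ f₃ f₄ f₅ : ℝ → ℂ} (h₁ : Integrable f₁)
    (h₂ : Integrable f₂) (h₃ : Integrable f₃) (h₄ : Integrable f₄) (h₅ : Integrable f₅)
    (c₁ c₂ c₃ c₄ c₅ : ℂ) :
    ∫ k, (c₁ * f₁ k + c₂ * f₂ k + c₃ * f₃ k + c₄ * f₄ k + c₅ * f₅ k) =
      c₁ * (∫ k, f₁ k) + c₂ * (∫ k, f₂ k) + c₃ * (∫ k, f₃ k) + c₄ * (∫ k, f₄ k) +
        c₅ * (∫ k, f₅ k) := by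
  have i₂ : Integrable fun k => c₁ * f₁ k + c₂ * f₂ k := (h₁.const_mul c₁).add (h₂.const_mul c₂)
  have i₃ : Integrable fun k => c₁ * f₁ k + c₂ * f₂ k + c₃ * f₃ k := i₂.add (h₃.const_mul c₃)
  have i₄ : Integrable fun k => c₁ * f₁ k + c₂ * f₂ k + c₃ * f₃ k + c₄ * f₄ k :=
    i₃.add (h₄.const_mul c₄)
  rw [← integral_const_mul, ← integral_const_mul, ← integral_const_mul, ← integral_const_mul,
    ← integral_const_mul, ← integral_add (h₁.const_mul c₁) (h₂.const_mul c₂),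
    ← integral_add i₂ (h₃.const_mul c₃), ← integral_add i₃ (h₄.const_mul c₄),
    ← integral_add i₄ (h₅.const_mul c₅)]

section

variable {u : ℝ → ℝ} (hu : ContDiff ℝ 7 u)
  (hu_int : ∀ k : ℕ, k ≤ 7 → Integrable (iteratedDeriv k u))
  {α : ℝ} (hα₀ : 0 < α) (hα₂ : α ≤ 2) (p q : ℤ)

include hu hu_int

lemma ofReal_eq_integral (x : ℝ) : (u x : ℂ) = ∫ k, Complex.exp (freq k * x) * hat u k := by
  rw [← fourierInv_hat hu hu_int, fourierInv_eq_integral]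

lemma ofReal_leftTerm (h x : ℝ) (j : ℕ) : (leftTerm α p q u h x j : ℂ) =
    ∫ k, (g α j : ℂ) * Complex.exp (-(freq k * h)) ^ j *
      ((mu1 α p q * Complex.exp (p * (freq k * h)) + mu2 α p q * Complex.exp (q * (freq k * h))) *
        (Complex.exp (freq k * x) * hat u k)) := by
  have hi := fun y => integrable_exp_freq_mul (integrable_hat hu hu_int) y
  rw [leftTerm]
  push_cast
  rw [ofReal_eq_integral hu hu_int, ofReal_eq_integral hu hu_int, ← integral_const_mul,
    ← integral_const_mul, ← integral_add ((hi _).const_mul _) ((hi _).const_mul _),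
    ← integral_const_mul]
  refine integral_congr_ae (Eventually.of_forall fun k => ?_)
  have hshift (r : ℤ) : Complex.exp (freq k * ((x - ((j : ℝ) - r) * h : ℝ) : ℂ)) =
      Complex.exp (-(freq k * h)) ^ j * Complex.exp (r * (freq k * h)) *
        Complex.exp (freq k * x) := by
    rw [← Complex.exp_nat_mul, ← Complex.exp_add, ← Complex.exp_add]
    congr 1
    push_cast
    ring
  simp only [hshift]
  ring

include hα₀ hα₂

lemma ofReal_tsum_leftTerm (h x : ℝ) : ((∑' j, leftTerm α p q u h x j : ℝ) : ℂ) =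
    ∫ k, wsgdSymbol α p q (freq k * h) * (Complex.exp (freq k * x) * hat u k) := by
  rw [Complex.ofReal_tsum]
  simp_rw [ofReal_leftTerm hu hu_int]
  have hi := integrable_exp_freq_mul (integrable_hat hu hu_int) x
  set A := |mu1 α p q| + |mu2 α p q|
  have hG : Integrable fun k => (mu1 α p q * Complex.exp (p * (freq k * h)) +
      mu2 α p q * Complex.exp (q * (freq k * h))) * (Complex.exp (freq k * x) * hat u k) := by
    refine hi.bdd_mul (c := A) (Continuous.aestronglyMeasurable (by fun_prop))
      (Eventually.of_forall fun k => (norm_add_le _ _).trans ?_)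
    have e (r : ℤ) : ‖Complex.exp (r * (freq k * h))‖ = 1 := norm_exp_of_re_eq_zero (by simp)
    simp [e, A]
  have hone (k : ℝ) : ‖Complex.exp (-(freq k * h))‖ = 1 := norm_exp_of_re_eq_zero (by simp)
  have hF (j : ℕ) : Integrable fun k => (g α j : ℂ) * Complex.exp (-(freq k * h)) ^ j *
      ((mu1 α p q * Complex.exp (p * (freq k * h)) + mu2 α p q * Complex.exp (q * (freq k * h))) *
        (Complex.exp (freq k * x) * hat u k)) := by
    refine hG.bdd_mul (c := |g α j|) (Continuous.aestronglyMeasurable (by fun_prop))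
      (Eventually.of_forall fun k => ?_)
    simp [hone]
  have hsum := hasSum_integral_of_summable_integral_norm hF ?_
  · rw [hsum.tsum_eq]
    refine integral_congr_ae (Eventually.of_forall fun k => ?_)
    simp only
    rw [tsum_mul_right, tsum_g_mul_pow hα₀ hα₂ (hone k).le, wsgdSymbol]
    ring
  · simp only [norm_mul _ (_ * (_ * hat u _)), norm_mul (g α _ : ℂ), norm_pow, hone, one_pow,
      mul_one, Complex.norm_real, Real.norm_eq_abs, integral_const_mul]
    exact (summable_abs_g hα₀ hα₂).mul_right _

/-- The error of the expansion is the Fourier multiplier given by the difference of the symbols. -/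
lemma ofReal_expansion_error {h : ℝ} (hh : 0 < h) (x : ℝ) :
    ((leftWSGD α p q u h x - (compactOp α p q h (leftRL α u) x +
      c α p q 3 * leftRL (α + 3) u x * h ^ 3) : ℝ) : ℂ) =
    ∫ k, (1 / (h ^ α : ℝ) : ℂ) * ((wsgdSymbol α p q (freq k * h) -
      expansionSymbol α p q (freq k * h)) * (Complex.exp (freq k * x) * hat u k)) := by
  have hrl (β : ℝ) (h0 : 0 < β) (h5 : β ≤ 5) (y : ℝ) : (leftRL β u y : ℂ) =
      ∫ k, Complex.exp (freq k * y) * (freq k ^ (β : ℂ) * hat u k) := by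
    rw [(leftRLExists_and_eq_fourierInv hu hu_int h0 h5).2, fourierInv_eq_integral]
  have hirl (β : ℝ) (h0 : 0 < β) (h5 : β ≤ 5) (y : ℝ) :
      Integrable fun k => Complex.exp (freq k * y) * (freq k ^ (β : ℂ) * hat u k) :=
    integrable_exp_freq_mul
      (integrable_freq_cpow_mul_hat hu hu_int (by linarith) (by linarith)) y
  have hiw : Integrable fun k =>
      wsgdSymbol α p q (freq k * h) * (Complex.exp (freq k * x) * hat u k) := by
    refine (integrable_exp_freq_mul (integrable_hat hu hu_int) x).bdd_mul
      (c := (|mu1 α p q| + |mu2 α p q|) * 2 ^ α) ?_ (Eventually.of_forall fun k => ?_)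
    · have : Measurable fun k : ℝ => wsgdSymbol α p q (freq k * h) := by
        unfold wsgdSymbol
        fun_prop
      exact this.aestronglyMeasurable
    · have e (r : ℤ) : ‖Complex.exp (r * (freq k * h))‖ = 1 := norm_exp_of_re_eq_zero (by simp)
      have e2 : ‖Complex.exp (-(freq k * h))‖ = 1 := norm_exp_of_re_eq_zero (by simp)
      rw [wsgdSymbol, norm_mul, Complex.norm_cpow_real]
      gcongr
      · refine (norm_add_le _ _).trans ?_
        simp [e]
      · refine (norm_sub_le _ _).trans ?_
        rw [e2, norm_one]
        norm_num
  have hhα : ((h ^ α : ℝ) : ℂ) ≠ 0 := by exact_mod_cast (Real.rpow_pos_of_pos hh α).ne'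
  have hh0 : (h : ℂ) ≠ 0 := by exact_mod_cast hh.ne'
  have hα5 : α ≤ 5 := by linarith
  have e1 (k : ℝ) : Complex.exp (freq k * ((x - h : ℝ) : ℂ)) =
      Complex.exp (freq k * x) * Complex.exp (-(freq k * h)) := by
    rw [← Complex.exp_add]
    congr 1
    push_cast
    ring
  have e2 (k : ℝ) : Complex.exp (freq k * ((x + h : ℝ) : ℂ)) =
      Complex.exp (freq k * x) * Complex.exp (freq k * h) := by
    rw [← Complex.exp_add]
    congr 1
    push_cast
    ring
  have e4 (k : ℝ) : freq k ^ ((α + 3 : ℝ) : ℂ) = freq k ^ (α : ℂ) * freq k ^ 3 := by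
    by_cases hk : freq k = 0
    · rw [hk, Complex.zero_cpow (by exact_mod_cast (by linarith : α + 3 ≠ 0))]
      simp
    · rw [Complex.ofReal_add, Complex.cpow_add _ _ hk, Complex.ofReal_ofNat, Complex.cpow_ofNat]
  calc _ = (1 / (h ^ α : ℝ) : ℂ) *
        (∫ k, wsgdSymbol α p q (freq k * h) * (Complex.exp (freq k * x) * hat u k)) +
        (-1 + 2 * c α p q 2 : ℂ) * (∫ k, Complex.exp (freq k * x) * (freq k ^ (α : ℂ) * hat u k)) +
        (-c α p q 2 : ℂ) *
          (∫ k, Complex.exp (freq k * (x - h : ℝ)) * (freq k ^ (α : ℂ) * hat u k)) +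
        (-c α p q 2 : ℂ) *
          (∫ k, Complex.exp (freq k * (x + h : ℝ)) * (freq k ^ (α : ℂ) * hat u k)) +
        (-(c α p q 3 * h ^ 3) : ℂ) *
          (∫ k, Complex.exp (freq k * x) * (freq k ^ ((α + 3 : ℝ) : ℂ) * hat u k)) := by
        rw [← ofReal_tsum_leftTerm hu hu_int hα₀ hα₂, ← hrl α hα₀ hα5, ← hrl α hα₀ hα5,
          ← hrl α hα₀ hα5, ← hrl (α + 3) (by linarith) (by linarith), leftWSGD, compactOp,
          centralDiff]
        push_cast [-Complex.ofReal_tsum]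
        field_simp
        ring
    _ = _ := by
        rw [← integral_linear_combination hiw (hirl α hα₀ hα5 x) (hirl α hα₀ hα5 (x - h))
          (hirl α hα₀ hα5 (x + h)) (hirl (α + 3) (by linarith) (by linarith) x)]
        refine integral_congr_ae (Eventually.of_forall fun k => ?_)
        simp only [e1, e2, e4]
        rw [expansionSymbol, mul_ofReal_cpow hα₀ hh]
        field_simp
        ring

/-- For `α < 2` the remainder is bounded by `h⁴ ∫ |2πk|^{α+4} |û(k)| dk`, up to a constant. -/
lemma uniformBigO_four_of_lt_two (hpq : p ≠ q) (hα₂' : α < 2) :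
    UniformBigO (fun h x => leftWSGD α p q u h x - (compactOp α p q h (leftRL α u) x +
      c α p q 3 * leftRL (α + 3) u x * h ^ 3)) 4 := by
  obtain ⟨C, hC0, hC⟩ := norm_symbol_sub_le hα₀ hpq
  have hint := integrable_norm_freq_rpow_mul_hat hu hu_int (γ := α + 4) (by linarith) (by linarith)
  refine ⟨C * ∫ k, ‖freq k‖ ^ (α + 4) * ‖hat u k‖, 1, one_pos, fun h hh _ x => ?_⟩
  have hhα : 0 < h ^ α := Real.rpow_pos_of_pos hh α
  rw [← Real.norm_eq_abs, ← Complex.norm_real, ofReal_expansion_error hu hu_int hα₀ hα₂ p q hh x,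
    mul_right_comm, ← integral_const_mul]
  have hbound : ∀ k, ‖(1 / (h ^ α : ℝ) : ℂ) * ((wsgdSymbol α p q (freq k * h) -
      expansionSymbol α p q (freq k * h)) * (Complex.exp (freq k * x) * hat u k))‖ ≤
      C * h ^ 4 * (‖freq k‖ ^ (α + 4) * ‖hat u k‖) := by
    intro k
    have h1 := hC (freq k * h) (by simp)
    rw [norm_mul (freq k), Complex.norm_real, Real.norm_of_nonneg hh.le,
      Real.mul_rpow (norm_nonneg _) hh.le, Real.rpow_add hh] at h1
    rw [norm_mul, norm_mul, norm_mul, norm_exp_freq_mul, one_mul, norm_div, norm_one,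
      Complex.norm_real, Real.norm_of_nonneg hhα.le]
    calc _ ≤ 1 / h ^ α * (C * (‖freq k‖ ^ (α + 4) * (h ^ α * h ^ (4 : ℝ))) * ‖hat u k‖) := by
          gcongr
      _ = _ := by
          rw [show h ^ (4 : ℝ) = h ^ 4 by norm_cast]
          field_simp
  exact norm_integral_le_of_norm_le (hint.const_mul _) (Eventually.of_forall hbound)

end

/-- The remainder of order four and boundedness of the derivative of order `α + 3` give the
expansion with remainder of order three. -/
lemma UniformBigO.of_four {c M : ℝ} {F : ℝ → ℝ} (hF : ∀ x, |F x| ≤ M)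
    {A B : ℝ → ℝ → ℝ} (hE : UniformBigO (fun h x => A h x - (B h x + c * F x * h ^ 3)) 4) :
    UniformBigO (fun h x => A h x - B h x) 3 := by
  obtain ⟨C, h₀, hh₀, hC⟩ := hE
  refine ⟨|C| + |c| * M, min h₀ 1, lt_min hh₀ one_pos, fun h hh hlt x => ?_⟩
  have h1 := hC h hh (hlt.trans_le (min_le_left _ _)) x
  have hle : h ≤ 1 := (hlt.trans_le (min_le_right _ _)).le
  have h2 : C * h ^ 4 ≤ |C| * h ^ 3 := by
    have : h ^ 4 ≤ h ^ 3 := pow_le_pow_of_le_one hh.le hle (by norm_num)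
    exact mul_le_mul (le_abs_self C) this (by positivity) (abs_nonneg C)
  have h3 : |c * F x * h ^ 3| ≤ |c| * M * h ^ 3 := by
    rw [abs_mul, abs_mul, abs_of_pos (by positivity : 0 < h ^ 3)]
    gcongr
    exact hF x
  calc |A h x - B h x| = |(A h x - (B h x + c * F x * h ^ 3)) + c * F x * h ^ 3| := by
        congr 1; ring
    _ ≤ C * h ^ 4 + |c| * M * h ^ 3 := (abs_add_le _ _).trans (add_le_add h1 h3)
    _ ≤ _ := by rw [add_mul]; gcongr

/-! ### The integer order two: Taylor expansion of finite differences -/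

/-- Taylor's formula with a remainder bound valid on both sides of the base point. The constant is
not divided by `n!`, which keeps the induction (by the mean value inequality) free of integrals. -/
lemma abs_sub_taylor_le {n : ℕ} {f : ℝ → ℝ} (hf : ContDiff ℝ n f) {M : ℝ}
    (hM : ∀ x, |iteratedDeriv n f x| ≤ M) (x y : ℝ) :
    |f (x + y) - ∑ i ∈ Finset.range n, iteratedDeriv i f x * y ^ i / i.factorial| ≤
      M * |y| ^ n := by
  induction n generalizing f y with
  | zero => simpa using hM (x + y)
  | succ n ih =>
    have hM0 : 0 ≤ M := (abs_nonneg _).trans (hM x)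
    have hd := (contDiff_succ_iff_deriv (n := n)).1 (by exact_mod_cast hf)
    have ih' := fun t => ih hd.2.2 (fun z => by rw [← iteratedDeriv_succ']; exact hM z) t
    set F : ℝ → ℝ := fun y =>
      f (x + y) - ∑ i ∈ Finset.range (n + 1), iteratedDeriv i f x * y ^ i / i.factorial
    have hF (t : ℝ) : HasDerivAt F (deriv f (x + t) -
        ∑ i ∈ Finset.range n, iteratedDeriv i (deriv f) x * t ^ i / i.factorial) t := by
      have h1 : HasDerivAt (fun y => f (x + y)) (deriv f (x + t)) t :=
        (hd.1 (x + t)).hasDerivAt.comp_const_add x t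
      have h2 : HasDerivAt (fun y : ℝ => ∑ i ∈ Finset.range (n + 1),
          iteratedDeriv i f x * y ^ i / i.factorial)
          (∑ i ∈ Finset.range (n + 1),
            iteratedDeriv i f x * (i * t ^ (i - 1)) / i.factorial) t :=
        HasDerivAt.fun_sum fun i _ => ((hasDerivAt_pow i t).const_mul _).div_const _
      refine (h1.sub h2).congr_deriv ?_
      rw [Finset.sum_range_succ']
      simp only [Nat.cast_zero, zero_mul, mul_zero, zero_div, add_zero, Nat.add_sub_cancel]
      congr 1
      refine Finset.sum_congr rfl fun i _ => ?_
      rw [← iteratedDeriv_succ', Nat.factorial_succ]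
      push_cast
      field_simp
    have hseg : ∀ t ∈ uIcc 0 y, ‖deriv f (x + t) -
        ∑ i ∈ Finset.range n, iteratedDeriv i (deriv f) x * t ^ i / i.factorial‖ ≤
        M * |y| ^ n := by
      intro t ht
      refine (ih' t).trans ?_
      have : |t| ≤ |y| := by simpa using abs_sub_left_of_mem_uIcc ht
      gcongr
    have h := (convex_uIcc 0 y).norm_image_sub_le_of_norm_hasDerivWithin_le
      (fun t _ => (hF t).hasDerivWithinAt) hseg left_mem_uIcc right_mem_uIcc
    have hF0 : F 0 = 0 := by simp [F, Finset.sum_range_succ']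
    rw [hF0, sub_zero, sub_zero, Real.norm_eq_abs, Real.norm_eq_abs] at h
    rw [pow_succ, ← mul_assoc]
    exact h

lemma exists_bound_of_integrable_deriv {f : ℝ → ℝ} (hf : ContDiff ℝ 1 f)
    (hi : Integrable (deriv f)) : ∃ M, ∀ x, |f x| ≤ M := by
  refine ⟨|f 0| + ∫ t, |deriv f t|, fun x => ?_⟩
  have h := intervalIntegral.integral_deriv_eq_sub (f := f) (a := 0) (b := x)
    (fun t _ => hf.differentiable (by norm_num) t) hi.intervalIntegrable
  have h1 : |∫ t in (0 : ℝ)..x, deriv f t| ≤ ∫ t, |deriv f t| :=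
    (intervalIntegral.norm_integral_le_integral_norm_uIoc (f := deriv f)).trans
      (setIntegral_le_integral hi.norm (Eventually.of_forall fun _ => norm_nonneg _))
  rw [h] at h1
  have h2 := abs_add_le (f 0) (f x - f 0)
  rw [add_sub_cancel] at h2
  linarith

/-- A polynomial of degree less than `n` that is `O(z^n)` at `0` vanishes. -/
lemma coeff_eq_zero_of_isBigO {n : ℕ} {e : ℕ → ℂ}
    (h : (fun z : ℂ => ∑ i ∈ Finset.range n, e i * z ^ i) =O[𝓝 0] fun z => z ^ n) :
    ∀ i < n, e i = 0 := by
  induction n with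
  | zero => simp
  | succ n ih =>
    have hlow : ∀ i < n, e i = 0 := by
      refine ih ?_
      have h1 : (fun z : ℂ => z ^ (n + 1)) =O[𝓝 0] fun z => z ^ n :=
        (Asymptotics.isLittleO_pow_pow (Nat.lt_succ_self n)).isBigO
      have h2 : (fun z : ℂ => e n * z ^ n) =O[𝓝 0] fun z => z ^ n :=
        (Asymptotics.isBigO_refl _ _).const_mul_left _
      refine ((h.trans h1).sub h2).congr_left fun z => ?_
      rw [Finset.sum_range_succ, add_sub_cancel_right]
    intro i hi
    rcases Nat.lt_succ_iff_lt_or_eq.1 hi with hi | rfl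
    · exact hlow i hi
    · by_contra hne
      have h1 : (fun z : ℂ => e i * z ^ i) =O[𝓝 0] fun z => z ^ (i + 1) := by
        refine h.congr_left fun z => ?_
        rw [Finset.sum_range_succ, Finset.sum_eq_zero, zero_add]
        intro j hj
        rw [hlow j (Finset.mem_range.1 hj), zero_mul]
      have h2 := h1.trans_isLittleO (Asymptotics.isLittleO_pow_pow (Nat.lt_succ_self i))
      rw [Asymptotics.isLittleO_const_mul_left_iff hne] at h2
      refine Asymptotics.isLittleO_irrefl ?_ h2
      have : ∀ᶠ z in 𝓝[≠] (0 : ℂ), z ^ i ≠ 0 := by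
        filter_upwards [self_mem_nhdsWithin] with z hz
        exact pow_ne_zero i hz
      exact this.frequently.filter_mono nhdsWithin_le_nhds

lemma g_zero (α : ℝ) : g α 0 = 1 := by simp [g]

lemma g_two_one : g 2 1 = -2 := by
  have := g_succ_mul 2 0
  norm_num [g_zero] at this
  linarith

lemma g_two_two : g 2 2 = 1 := by
  have := g_succ_mul 2 1
  norm_num [g_two_one] at this
  linarith

lemma g_two_eq_zero (k : ℕ) : g 2 (k + 3) = 0 := by
  induction k with
  | zero =>
    have := g_succ_mul 2 2
    norm_num at this
    exact this
  | succ k ih =>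
    have := g_succ_mul 2 (k + 3)
    rw [ih, mul_zero] at this
    exact (mul_eq_zero.1 this).resolve_left (by positivity)

/-- The normalized moments of the WSGD stencil of order two. -/
noncomputable def moment (p q : ℤ) (i : ℕ) : ℝ :=
  (∑ j ∈ Finset.range 3, g 2 j *
    (mu1 2 p q * ((p : ℝ) - j) ^ i + mu2 2 p q * ((q : ℝ) - j) ^ i)) / i.factorial

lemma isBigO_exp_mul_sub (r : ℂ) : (fun z => Complex.exp (r * z) -
    ∑ i ∈ Finset.range 6, r ^ i / i.factorial * z ^ i) =O[𝓝 0] fun z : ℂ => z ^ 6 := by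
  have hA : AnalyticAt ℂ Complex.exp 0 := by fun_prop
  have h := isBigO_sub_taylor hA 6
  simp only [iteratedDeriv_eq_iterate, Complex.iter_deriv_exp, Complex.exp_zero] at h
  have hn : Tendsto (fun z : ℂ => r * z) (𝓝 0) (𝓝 0) := by
    simpa using (continuous_const_mul r).tendsto 0
  refine ((h.comp_tendsto hn).trans ?_).congr_left fun z => ?_
  · simp only [Function.comp_def, mul_pow]
    exact (Asymptotics.isBigO_refl _ _).const_mul_left _
  · simp only [Function.comp_def]
    congr 1
    refine Finset.sum_congr rfl fun i _ => ?_
    ring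

/-- The symbol of the WSGD operator of order two, expanded in two ways. -/
lemma moment_eq {p q : ℤ} (hpq : p ≠ q) : moment p q 0 = 0 ∧ moment p q 1 = 0 ∧
    moment p q 2 = 1 ∧ moment p q 3 = 0 ∧ moment p q 4 = c 2 p q 2 ∧
    moment p q 5 = c 2 p q 3 := by
  have h1 : (fun z => wsgdSymbol 2 p q z - ∑ i ∈ Finset.range 6, (moment p q i : ℂ) * z ^ i)
      =O[𝓝 0] fun z : ℂ => z ^ 6 := by
    have hj (j : ℕ) := (((isBigO_exp_mul_sub ((p : ℂ) - j)).const_mul_left (mu1 2 p q : ℂ)).add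
      ((isBigO_exp_mul_sub ((q : ℂ) - j)).const_mul_left (mu2 2 p q : ℂ))).const_mul_left
        (g 2 j : ℂ)
    refine (((hj 0).add (hj 1)).add (hj 2)).congr_left fun z => ?_
    have e (r : ℤ) (j : ℕ) : Complex.exp (((r : ℂ) - j) * z) =
        Complex.exp (r * z) * Complex.exp (-z) ^ j := by
      rw [← Complex.exp_nat_mul, ← Complex.exp_add]
      congr 1
      ring
    rw [wsgdSymbol, Complex.ofReal_ofNat, Complex.cpow_ofNat]
    simp only [e, g_zero, g_two_one, g_two_two, Finset.sum_range_succ, Finset.sum_range_zero,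
      moment]
    push_cast
    ring
  have h2 : (fun z => wsgdSymbol 2 p q z - (z ^ 2 + c 2 p q 2 * z ^ 4 + c 2 p q 3 * z ^ 5))
      =O[𝓝 0] fun z : ℂ => z ^ 6 := by
    have h := (Asymptotics.isBigO_refl (fun z : ℂ => z ^ 2) (𝓝 0)).mul
      (isBigO_weighted_wExt_sub (α := 2) hpq)
    refine (h.congr_right fun z => by ring).congr_left fun z => ?_
    rw [wsgdSymbol, wExt, wExt, Complex.ofReal_ofNat, Complex.cpow_ofNat, Complex.cpow_ofNat,
      ← mul_expQuot]
    ring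
  set d : ℕ → ℂ := fun i =>
    if i = 2 then 1 else if i = 4 then c 2 p q 2 else if i = 5 then c 2 p q 3 else 0 with hd
  have h3 : ∀ i < 6, d i - (moment p q i : ℂ) = 0 := by
    refine coeff_eq_zero_of_isBigO ((h1.sub h2).congr_left fun z => ?_)
    simp [Finset.sum_range_succ, hd]
    ring
  have h4 : ∀ i < 6, (moment p q i : ℂ) = d i := fun i hi => (sub_eq_zero.1 (h3 i hi)).symm
  refine ⟨?_, ?_, ?_, ?_, ?_, ?_⟩
  · have := h4 0 (by norm_num); simp [hd] at this; exact this
  · have := h4 1 (by norm_num); simp [hd] at this; exact this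
  · have := h4 2 (by norm_num); simp [hd] at this; exact_mod_cast this
  · have := h4 3 (by norm_num); simp [hd] at this; exact this
  · have := h4 4 (by norm_num); simp [hd] at this; exact_mod_cast this
  · have := h4 5 (by norm_num); simp [hd] at this; exact_mod_cast this

lemma leftRL_natCast (n : ℕ) (u : ℝ → ℝ) : leftRL n u = iteratedDeriv n u := by
  funext x
  rw [leftRL, if_pos (by simp), Nat.ceil_natCast]

lemma sum_leftTerm_two_sub_le {p q : ℤ} {u : ℝ → ℝ} (hu : ContDiff ℝ 6 u) {M : ℝ}
    (hM : ∀ x, |iteratedDeriv 6 u x| ≤ M) : ∃ K, ∀ h x : ℝ, 0 < h →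
    |∑' j, leftTerm 2 p q u h x j -
      ∑ i ∈ Finset.range 6, moment p q i * iteratedDeriv i u x * h ^ i| ≤ K * h ^ 6 := by
  refine ⟨∑ j ∈ Finset.range 3, |g 2 j| * (|mu1 2 p q| * (M * |(p : ℝ) - j| ^ 6) +
    |mu2 2 p q| * (M * |(q : ℝ) - j| ^ 6)), fun h x hh => ?_⟩
  set R : ℝ → ℝ := fun r =>
    u (x + r * h) - ∑ i ∈ Finset.range 6, iteratedDeriv i u x * (r * h) ^ i / i.factorial with hR
  have hRle (r : ℝ) : |R r| ≤ M * |r| ^ 6 * h ^ 6 := by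
    have := abs_sub_taylor_le (n := 6) hu hM x (r * h)
    rwa [abs_mul, abs_of_pos hh, mul_pow, ← mul_assoc] at this
  have htsum : ∑' j, leftTerm 2 p q u h x j = ∑ j ∈ Finset.range 3, leftTerm 2 p q u h x j := by
    refine tsum_eq_sum fun j hj => ?_
    obtain ⟨k, rfl⟩ := Nat.exists_eq_add_of_le' (by simpa using hj : 3 ≤ j)
    rw [leftTerm, g_two_eq_zero, zero_mul]
  have hsplit : ∑' j, leftTerm 2 p q u h x j -
      ∑ i ∈ Finset.range 6, moment p q i * iteratedDeriv i u x * h ^ i =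
      ∑ j ∈ Finset.range 3, g 2 j *
        (mu1 2 p q * R ((p : ℝ) - j) + mu2 2 p q * R ((q : ℝ) - j)) := by
    have e (r : ℤ) (j : ℕ) : x - ((j : ℝ) - r) * h = x + ((r : ℝ) - j) * h := by ring
    rw [htsum]
    simp only [leftTerm, e, hR, moment, Finset.sum_range_succ, Finset.sum_range_zero]
    ring
  rw [hsplit, Finset.sum_mul]
  refine (Finset.abs_sum_le_sum_abs _ _).trans (Finset.sum_le_sum fun j _ => ?_)
  rw [abs_mul, mul_assoc]
  gcongr
  refine (abs_add_le _ _).trans ?_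
  rw [abs_mul, abs_mul, add_mul, mul_assoc, mul_assoc |mu2 2 p q|]
  gcongr
  · exact hRle _
  · exact hRle _

lemma iteratedDeriv_iteratedDeriv (m n : ℕ) (u : ℝ → ℝ) :
    iteratedDeriv m (iteratedDeriv n u) = iteratedDeriv (m + n) u := by
  simp only [iteratedDeriv_eq_iterate, Function.iterate_add_apply]

/-- For `α = 2`, where `|k|^{α+4} |û|` need not be integrable, the remainder is estimated by the
supremum of the sixth derivative. -/
lemma uniformBigO_four_of_eq_two {u : ℝ → ℝ} (hu : ContDiff ℝ 7 u)
    (hu_int : Integrable (iteratedDeriv 7 u)) {p q : ℤ} (hpq : p ≠ q) :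
    UniformBigO (fun h x => leftWSGD 2 p q u h x - (compactOp 2 p q h (leftRL 2 u) x +
      c 2 p q 3 * leftRL (2 + 3) u x * h ^ 3)) 4 := by
  have hu6 : ContDiff ℝ 6 u := hu.of_le (by norm_num)
  obtain ⟨M, hM⟩ := exists_bound_of_integrable_deriv (f := iteratedDeriv 6 u)
    (by rw [iteratedDeriv_eq_iterate]; exact ContDiff.iterate_deriv' 1 6 hu)
    (by rwa [← iteratedDeriv_succ])
  obtain ⟨K, hK⟩ := sum_leftTerm_two_sub_le (p := p) (q := q) hu6 hM
  obtain ⟨m0, m1, m2, m3, m4, m5⟩ := moment_eq hpq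
  have hv : ContDiff ℝ 4 (iteratedDeriv 2 u) := by
    rw [iteratedDeriv_eq_iterate]
    exact ContDiff.iterate_deriv' 4 2 hu6
  have hT := abs_sub_taylor_le (n := 4) hv (M := M)
    (fun x => by rw [iteratedDeriv_iteratedDeriv]; exact hM x)
  refine ⟨K + |c 2 p q 2| * (2 * M), 1, one_pos, fun h hh _ x => ?_⟩
  have t1 := hT x h
  have t2 := hT x (-h)
  have t3 := hK h x hh
  have r2 : leftRL 2 u = iteratedDeriv 2 u := by exact_mod_cast leftRL_natCast 2 u
  have r5 : leftRL (2 + 3) u = iteratedDeriv 5 u := by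
    rw [show (2 + 3 : ℝ) = ((5 : ℕ) : ℝ) by norm_num]
    exact leftRL_natCast 5 u
  simp only [Finset.sum_range_succ, Finset.sum_range_zero, m0, m1, m2, m3, m4, m5] at t3
  simp only [Finset.sum_range_succ, Finset.sum_range_zero, iteratedDeriv_iteratedDeriv, abs_neg,
    abs_of_pos hh, Nat.factorial] at t1 t2
  norm_num at t1 t2
  simp only [r2, r5, leftWSGD, compactOp, centralDiff]
  rw [show h ^ (2 : ℝ) = h ^ 2 by norm_cast]
  set S := ∑' j, leftTerm 2 p q u h x j
  set D := iteratedDeriv 2 u (x - h) - 2 * iteratedDeriv 2 u x + iteratedDeriv 2 u (x + h) with hD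
  have hD' : |D - h ^ 2 * iteratedDeriv 4 u x| ≤ 2 * M * h ^ 4 := by
    rw [abs_le] at t1 t2 ⊢
    rw [← sub_eq_add_neg] at t2
    constructor <;> nlinarith [t1.1, t1.2, t2.1, t2.2]
  have hsplit : 1 / h ^ 2 * S - (iteratedDeriv 2 u x + c 2 p q 2 * h ^ 2 * (D / h ^ 2) +
      c 2 p q 3 * iteratedDeriv 5 u x * h ^ 3) =
      (S - (h ^ 2 * iteratedDeriv 2 u x + c 2 p q 2 * h ^ 4 * iteratedDeriv 4 u x +
        c 2 p q 3 * h ^ 5 * iteratedDeriv 5 u x)) / h ^ 2 +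
      -(c 2 p q 2 * (D - h ^ 2 * iteratedDeriv 4 u x)) := by
    field_simp
    ring
  rw [hsplit, add_mul]
  refine (abs_add_le _ _).trans (add_le_add ?_ ?_)
  · rw [abs_div, abs_of_pos (by positivity : 0 < h ^ 2), div_le_iff₀ (by positivity)]
    refine le_trans (le_of_eq ?_) (t3.trans (le_of_eq (by ring)))
    congr 1
    ring
  · rw [abs_neg, abs_mul, mul_assoc]
    gcongr

/-! ### Reflection -/

lemma rightKernelIntegral_eq (s : ℝ) (u : ℝ → ℝ) :
    rightKernelIntegral s u = fun x => leftKernelIntegral s (fun y => u (-y)) (-x) := by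
  funext x
  rw [rightKernelIntegral, leftKernelIntegral]
  have h := (Measure.measurePreserving_neg (volume : Measure ℝ)).setIntegral_preimage_emb
    (Homeomorph.neg ℝ).measurableEmbedding (fun ξ => u ξ / (ξ - x) ^ s) (Ioi x)
  rw [← h, Set.neg_preimage, Set.neg_Ioi]
  refine setIntegral_congr_fun measurableSet_Iio fun t _ => ?_
  rw [show -x - t = -t - x by ring]

lemma rightRL_eq (β : ℝ) (u : ℝ → ℝ) :
    rightRL β u = fun x => leftRL β (fun y => u (-y)) (-x) := by
  funext x
  rw [rightRL, leftRL]
  split_ifs with h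
  · rw [iteratedDeriv_comp_neg, neg_neg, smul_eq_mul]
  · rw [rightKernelIntegral_eq, iteratedDeriv_comp_neg, smul_eq_mul]
    have : ((-1 : ℝ) ^ ⌈β⌉₊) * (-1) ^ ⌈β⌉₊ = 1 := by rw [← mul_pow]; simp
    linear_combination (1 / Real.Gamma (⌈β⌉₊ - β) * iteratedDeriv ⌈β⌉₊
      (leftKernelIntegral (β - ⌈β⌉₊ + 1) fun y => u (-y)) (-x)) * this

lemma rightRLExists_of_left {β : ℝ} {u : ℝ → ℝ} (h : LeftRLExists β fun y => u (-y)) :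
    RightRLExists β u := by
  refine ⟨fun hβ => ?_, fun hβ => ⟨fun x => ?_, ?_⟩⟩
  · simpa [Function.comp_def] using (h.1 hβ).comp contDiff_neg
  · have h1 := ((h.2 hβ).1 (-x)).comp_neg
    rw [Set.neg_Iio, neg_neg] at h1
    refine h1.congr_fun (fun t _ => ?_) measurableSet_Ioi
    simp only [neg_neg]
    rw [show -x - -t = t - x by ring]
  · rw [rightKernelIntegral_eq]
    exact (h.2 hβ).2.comp contDiff_neg

lemma rightTerm_eq (α : ℝ) (p q : ℤ) (u : ℝ → ℝ) (h x : ℝ) :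
    rightTerm α p q u h x = leftTerm α p q (fun y => u (-y)) h (-x) := by
  funext k
  rw [rightTerm, leftTerm]
  congr 4 <;> ring_nf

lemma rightWSGD_eq (α : ℝ) (p q : ℤ) (u : ℝ → ℝ) (h x : ℝ) :
    rightWSGD α p q u h x = leftWSGD α p q (fun y => u (-y)) h (-x) := by
  rw [rightWSGD, leftWSGD, rightTerm_eq]

lemma compactOp_comp_neg (α : ℝ) (p q : ℤ) (h : ℝ) (f : ℝ → ℝ) (x : ℝ) :
    compactOp α p q h (fun y => f (-y)) x = compactOp α p q h f (-x) := by
  simp only [compactOp, centralDiff]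
  rw [show -(x - h) = -x + h by ring, show -(x + h) = -x - h by ring]
  ring

lemma UniformBigO.comp_neg {E : ℝ → ℝ → ℝ} {m : ℕ} (hE : UniformBigO E m) :
    UniformBigO (fun h x => E h (-x)) m := by
  obtain ⟨C, h₀, hh₀, hC⟩ := hE
  exact ⟨C, h₀, hh₀, fun h hh hlt x => hC h hh hlt (-x)⟩

lemma integrable_iteratedDeriv_comp_neg {u : ℝ → ℝ} {k : ℕ}
    (h : Integrable (iteratedDeriv k u)) : Integrable (iteratedDeriv k fun y => u (-y)) := by
  have : iteratedDeriv k (fun y => u (-y)) = fun y => (-1) ^ k * iteratedDeriv k u (-y) :=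
    funext fun y => iteratedDeriv_comp_neg k u y
  rw [this]
  exact h.comp_neg.const_mul _

/-! ### The expansions -/

section

variable {u : ℝ → ℝ} (hu : ContDiff ℝ 7 u)
  (hu_int : ∀ k : ℕ, k ≤ 7 → Integrable (iteratedDeriv k u))
  {α : ℝ} (hα₀ : 0 < α) (hα₂ : α ≤ 2) {p q : ℤ} (hpq : p ≠ q)

include hu hu_int hα₀ hα₂ hpq

lemma leftWSGD_expansion :
    UniformBigO (fun h x => leftWSGD α p q u h x - (compactOp α p q h (leftRL α u) x +
      c α p q 3 * leftRL (α + 3) u x * h ^ 3)) 4 := by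
  rcases hα₂.lt_or_eq with h | rfl
  · exact uniformBigO_four_of_lt_two hu hu_int hα₀ hα₂ p q hpq h
  · exact uniformBigO_four_of_eq_two hu (hu_int 7 le_rfl) hpq

lemma leftWSGD_third_order :
    UniformBigO (fun h x => leftWSGD α p q u h x - compactOp α p q h (leftRL α u) x) 3 := by
  obtain ⟨M, hM⟩ := exists_bound_leftRL hu hu_int (β := α + 3) (by linarith) (by linarith)
  exact UniformBigO.of_four hM (leftWSGD_expansion hu hu_int hα₀ hα₂ hpq)

end

end CWSGD

theorem proposition1 (α : ℝ) (hα₀ : 0 < α) (hα₂ : α ≤ 2) (p q : ℤ) (hpq : p ≠ q)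
    (u : ℝ → ℝ)
    (hu : ContDiff ℝ 7 u)
    (hu_int : ∀ k : ℕ, k ≤ 7 → MeasureTheory.Integrable (iteratedDeriv k u))
    (hL : MeasureTheory.Integrable (CWSGD.leftRL (α + 2) u))
    (hR : MeasureTheory.Integrable (CWSGD.rightRL (α + 2) u))
    (hL_fourier : MeasureTheory.Integrable
      (𝓕 (fun x : ℝ => (CWSGD.leftRL (α + 2) u x : ℂ))))
    (hR_fourier : MeasureTheory.Integrable
      (𝓕 (fun x : ℝ => (CWSGD.rightRL (α + 2) u x : ℂ)))) :
    -- all the objects in the expansions are well defined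
    (CWSGD.LeftRLExists α u ∧ CWSGD.LeftRLExists (α + 3) u ∧
      CWSGD.RightRLExists α u ∧ CWSGD.RightRLExists (α + 3) u ∧
      ∀ h x : ℝ, 0 < h →
        Summable (CWSGD.leftTerm α p q u h x) ∧ Summable (CWSGD.rightTerm α p q u h x)) ∧
    -- the expansions with remainder `O(h^4)`
    CWSGD.UniformBigO (fun h x => CWSGD.leftWSGD α p q u h x -
      (CWSGD.compactOp α p q h (CWSGD.leftRL α u) x +
        CWSGD.c α p q 3 * CWSGD.leftRL (α + 3) u x * h ^ 3)) 4 ∧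
    CWSGD.UniformBigO (fun h x => CWSGD.rightWSGD α p q u h x -
      (CWSGD.compactOp α p q h (CWSGD.rightRL α u) x +
        CWSGD.c α p q 3 * CWSGD.rightRL (α + 3) u x * h ^ 3)) 4 ∧
    -- hence third-order accuracy
    CWSGD.UniformBigO (fun h x => CWSGD.leftWSGD α p q u h x -
      CWSGD.compactOp α p q h (CWSGD.leftRL α u) x) 3 ∧
    CWSGD.UniformBigO (fun h x => CWSGD.rightWSGD α p q u h x -
      CWSGD.compactOp α p q h (CWSGD.rightRL α u) x) 3 := by
  have hu' : ContDiff ℝ 7 fun y => u (-y) := hu.comp contDiff_neg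
  have hu_int' : ∀ k : ℕ, k ≤ 7 → MeasureTheory.Integrable (iteratedDeriv k fun y => u (-y)) :=
    fun k hk => CWSGD.integrable_iteratedDeriv_comp_neg (hu_int k hk)
  have hα3 : 0 < α + 3 := by linarith
  have hα5 : α ≤ 5 := by linarith
  have hα35 : α + 3 ≤ 5 := by linarith
  obtain ⟨M, hM⟩ := CWSGD.exists_bound hu hu_int
  refine ⟨⟨(CWSGD.leftRLExists_and_eq_fourierInv hu hu_int hα₀ hα5).1,
    (CWSGD.leftRLExists_and_eq_fourierInv hu hu_int hα3 hα35).1,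
    CWSGD.rightRLExists_of_left (CWSGD.leftRLExists_and_eq_fourierInv hu' hu_int' hα₀ hα5).1,
    CWSGD.rightRLExists_of_left (CWSGD.leftRLExists_and_eq_fourierInv hu' hu_int' hα3 hα35).1,
    fun h x _ => ⟨CWSGD.summable_leftTerm hα₀ hα₂ p q hM h x, ?_⟩⟩,
    CWSGD.leftWSGD_expansion hu hu_int hα₀ hα₂ hpq, ?_,
    CWSGD.leftWSGD_third_order hu hu_int hα₀ hα₂ hpq, ?_⟩
  · rw [CWSGD.rightTerm_eq]
    exact CWSGD.summable_leftTerm hα₀ hα₂ p q (fun y => hM (-y)) h (-x)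
  · simp only [CWSGD.rightWSGD_eq, CWSGD.rightRL_eq, CWSGD.compactOp_comp_neg]
    exact (CWSGD.leftWSGD_expansion hu' hu_int' hα₀ hα₂ hpq).comp_neg
  · simp only [CWSGD.rightWSGD_eq, CWSGD.rightRL_eq, CWSGD.compactOp_comp_neg]
    exact (CWSGD.leftWSGD_third_order hu' hu_int' hα₀ hα₂ hpq).comp_neg
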